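/- Let $d\ge 1$ and $n\ge 1$ be integers. Let $\mathbb B_d$ be the open Euclidean unit ball of $\mathbb C^d$, with $\langle z,w\rangle=\sum_j z_j\overline{w_j}$, and let $H^2_d$ be the Drury–Arveson space, that is, the completion of $\mathbb C[z_1,\dots,z_d]$ for the inner product $\langle z^\alpha,z^\beta\rangle=\delta_{\alpha,\beta}\,\alpha!/|\alpha|!$, regarded as a Hilbert space of functions on $\mathbb B_d$. Let $\mathcal M_d$ be its multiplier algebra, let $M_f$ denote multiplication by $f\in\mathcal M_d$, and let $M_z=(M_{z_1},\dots,M_{z_d})$. Put $$\mathbb P_{d,n}=\{P\in B(H^2_d) : P=P^2=P^*,\ PM_f^*P=M_f^*P\ \text{for all } f\in\mathcal M_d,\ \dim PH^2_d=n\},$$ with the topology of the operator norm. Let $\mathbb X_{d,n}=\mathbb B_d^n/S_n$ be the symmetrized polyball; its points are identified with formal sums $\sum_\lambda m_\lambda[\lambda]$ of points $\lambda\in\mathbb B_d$ with coefficients $m_\lambda\in\{0,1,2,\dots\}$ and $\sum_\lambda m_\lambda=n$. It carries the symmetric distance $$d_s([X],[Y])=\min_{\sigma\in S_n}\ \max_{1\le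 j\le n}\|\varphi_{x_j}(y_{\sigma(j)})\|,$$ where $\varphi_\lambda(z)=\dfrac{\lambda-P_\lambda z-\sqrt{1-\|\lambda\|^2}\,(z-P_\lambda z)}{1-\langle z,\lambda\rangle}$ with $P_\lambda z=\|\lambda\|^{-2}\langle z,\lambda\rangle\lambda$ for $\lambda\neq0$ and $P_0=0$. For a commuting tuple $A=(A_1,\dots,A_d)$ of linear operators on an $n$-dimensional complex vector space, let $\sigma(A)=\{\lambda\in\mathbb C^d : \bigcap_j\ker(A_j-\lambda_jI)\ne\{0\}\}$, let $R_\lambda(A)=\bigcap_{|\alpha|=n}\ker (A-\lambda I)^\alpha$, and let $\sigma_J(A)=\sum_{\lambda\in\sigma(A)}\dim R_\lambda(A)\,[\lambda]$. Then $\Psi_{d,n}(P)=\sigma_J(PM_z|_{PH^2_d})$ is a well-defined map $\Psi_{d,n}:\mathbb P_{d,n}\to\mathbb X_{d,n}$ (that is, the joint spectrum of the compressed shift lies in $\mathbb B_d$ and its multiplicities add up to $n$), and it is surjective and continuous with respect to the operator norm on $\mathbb P_{d,n}$ and the distance $d_s$ on $\mathbb X_{d,n}$. -/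

import Mathlib

noncomputable section

namespace DruryArveson

/-- The open unit ball of `ℂ^d` with the Euclidean norm. -/
abbrev Ball (d : ℕ) : Type := ↥(Metric.ball (0 : EuclideanSpace ℂ (Fin d)) 1)

/-! ### The symmetrized polyball and the symmetric distance -/

/-- The automorphism `φ_l` of the ball that exchanges `l` and `0`,
`φ_l(z) = (l - P_l z - √(1 - ‖l‖²) (z - P_l z)) / (1 - ⟨z, l⟩)`, where `P_l z = ‖l‖⁻² ⟨z, l⟩ l`
and `⟨z, l⟩ = ∑ z_j conj(l_j)`, which is `inner ℂ l z` in Mathlib's convention.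
For `l = 0` one has `P_l = 0` and the formula gives `φ_0(z) = -z`. -/
def ballInvolution {d : ℕ} (l z : EuclideanSpace ℂ (Fin d)) : EuclideanSpace ℂ (Fin d) :=
  let Plz : EuclideanSpace ℂ (Fin d) := (inner ℂ l z / ((‖l‖ ^ 2 : ℝ) : ℂ)) • l
  (1 - inner ℂ l z)⁻¹ • (l - Plz - ((√(1 - ‖l‖ ^ 2) : ℝ) : ℂ) • (z - Plz))

/-- The pseudohyperbolic distance `‖φ_z(w)‖` on the ball. -/
def phDist {d : ℕ} (z w : Ball d) : ℝ := ‖ballInvolution (z : EuclideanSpace ℂ (Fin d)) w‖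

/-- Two `n`-tuples of points of the ball are equivalent if they differ by a permutation. -/
def permSetoid (d n : ℕ) : Setoid (Fin n → Ball d) where
  r x y := ∃ s : Equiv.Perm (Fin n), y = x ∘ s
  iseqv :=
    { refl := fun x => ⟨1, rfl⟩
      symm := by
        rintro x y ⟨s, rfl⟩
        exact ⟨s⁻¹, by ext i; simp⟩
      trans := by
        rintro x y z ⟨s, rfl⟩ ⟨t, rfl⟩
        exact ⟨s * t, rfl⟩ }

/-- The symmetrized polyball: the quotient of the `n`-fold product of the ball by the
symmetric group. -/
def SymPolyball (d n : ℕ) : Type := Quotient (permSetoid d n)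

/-- `max_j d_ph(x_j, y_j)` on the polyball. -/
def polyDist {d n : ℕ} (x y : Fin n → Ball d) : ℝ := ⨆ j, phDist (x j) (y j)

/-- The symmetric distance: the minimum over all permutations `s` of `max_j d_ph(x_j, y_{s j})`. -/
def symDist {d n : ℕ} (X Y : SymPolyball d n) : ℝ :=
  Quotient.liftOn₂ X Y
    (fun x y => ⨅ s : Equiv.Perm (Fin n), polyDist x (y ∘ s))
    (by
      rintro x y _ _ ⟨s, rfl⟩ ⟨t, rfl⟩
      have key : ∀ u : Equiv.Perm (Fin n),
          polyDist (x ∘ s) ((y ∘ t) ∘ u) = polyDist x (y ∘ (t * u * s⁻¹ : Equiv.Perm (Fin n))) := by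
        intro u
        unfold polyDist
        rw [← s.iSup_comp (g := fun j =>
          phDist (x j) ((y ∘ (t * u * s⁻¹ : Equiv.Perm (Fin n))) j))]
        simp
      simp only [key]
      exact (((Equiv.mulLeft t).trans (Equiv.mulRight s⁻¹)).iInf_comp
        (g := fun u : Equiv.Perm (Fin n) => polyDist x (y ∘ u))).symm)

/-- The multiplicity of a point `l` of `ℂ^d` in the class of `(x_1, …, x_n)`, that is, the
coefficient of `[l]` in the formal sum `[x_1] + … + [x_n]`. -/
def SymPolyball.mult {d n : ℕ} (X : SymPolyball d n) (l : EuclideanSpace ℂ (Fin d)) : ℕ :=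
  Quotient.liftOn X
    (fun x => Nat.card {j : Fin n // (x j : EuclideanSpace ℂ (Fin d)) = l})
    (by
      rintro x _ ⟨s, rfl⟩
      exact (Nat.card_congr (s.subtypeEquiv (fun _ => Iff.rfl))).symm)

/-! ### Joint spectrum with multiplicities of a tuple of endomorphisms -/

section JointSpectrum

variable {d : ℕ} {V : Type*} [AddCommGroup V] [Module ℂ V]

/-- The joint spectrum: all `l` such that the endomorphisms `A_j - l_j` have a common nonzero
kernel vector. -/
def jointSpectrum (A : Fin d → Module.End ℂ V) : Set (EuclideanSpace ℂ (Fin d)) :=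
  {l | (⨅ j, LinearMap.ker (A j - l j • (1 : Module.End ℂ V))) ≠ ⊥}

/-- `A^α = A_1^{α_1} ⋯ A_d^{α_d}` -/
def tuplePow (A : Fin d → Module.End ℂ V) (α : Fin d → ℕ) : Module.End ℂ V :=
  (List.ofFn fun j => A j ^ α j).prod

/-- The root subspace: the intersection of the kernels of `(A - l)^α` over all multi-indices `α`
with `|α| = dim V`. -/
def rootSubspace (A : Fin d → Module.End ℂ V) (l : EuclideanSpace ℂ (Fin d)) : Submodule ℂ V :=
  ⨅ α : {α : Fin d → ℕ // ∑ j, α j = Module.finrank ℂ V},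
    LinearMap.ker (tuplePow (fun j => A j - l j • (1 : Module.End ℂ V)) α)

open Classical in
/-- The coefficient of `[l]` in the joint spectrum with multiplicities
`∑_{l ∈ σ(A)} dim R_l(A) [l]`. -/
def jointSpectrumMult (A : Fin d → Module.End ℂ V) (l : EuclideanSpace ℂ (Fin d)) : ℕ :=
  if l ∈ jointSpectrum A then Module.finrank ℂ (rootSubspace A l) else 0

end JointSpectrum

/-! ### The Drury–Arveson space -/

/-- `|α|! / α!`, the inverse of the square of the norm of `z^α` in the Drury–Arveson space. -/
def weight {d : ℕ} (α : Fin d → ℕ) : ℝ :=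
  ((∑ j, α j).factorial : ℝ) / ((∏ j, (α j).factorial : ℕ) : ℝ)

/-- The Drury–Arveson space `H²_d`, the completion of the polynomials for the inner product
`⟨z^α, z^β⟩ = δ_{αβ} α!/|α|!`, realized through the coordinates with respect to the orthonormal
basis `z^α / ‖z^α‖ = √(|α|!/α!) z^α`: the vector `f` is the function
`∑_α f_α √(|α|!/α!) z^α` on the ball, see `evalAt`. -/
abbrev DASpace (d : ℕ) : Type := lp (fun _ : Fin d → ℕ => ℂ) 2

/-- The value of `f` at the point `z` of the ball. -/
def evalAt {d : ℕ} (f : DASpace d) (z : Ball d) : ℂ :=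
  ∑' α : Fin d → ℕ, f α * (√(weight α) : ℂ) * ∏ j, (z : EuclideanSpace ℂ (Fin d)) j ^ α j

/-- The monomial `z^α` as a vector of the Drury–Arveson space. -/
def monomial {d : ℕ} (α : Fin d → ℕ) : DASpace d :=
  lp.single 2 α (((√(weight α))⁻¹ : ℝ) : ℂ)

lemma weight_pos {d : ℕ} (α : Fin d → ℕ) : 0 < weight α := by
  unfold weight
  have h1 : 0 < (∑ j, α j).factorial := Nat.factorial_pos _
  have h2 : 0 < ∏ j, (α j).factorial := Finset.prod_pos fun j _ => Nat.factorial_pos _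
  positivity

lemma inner_monomial {d : ℕ} (α β : Fin d → ℕ) :
    inner ℂ (monomial α) (monomial β) =
      if α = β then ((((∏ j, (α j).factorial : ℕ) : ℝ) / ((∑ j, α j).factorial : ℝ) : ℝ) : ℂ)
      else 0 := by
  unfold monomial
  rw [lp.inner_single_left]
  split_ifs with h
  · subst h
    rw [lp.single_apply_self]
    simp only [RCLike.inner_apply, Complex.conj_ofReal, ← Complex.ofReal_mul]
    rw [← mul_inv, Real.mul_self_sqrt (weight_pos α).le]
    simp [weight]
  · rw [lp.single_apply_ne _ _ _ h]
    simp

lemma dense_span_monomial (d : ℕ) :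
    Dense (Submodule.span ℂ (Set.range (monomial (d := d))) : Set (DASpace d)) := by
  intro f
  have hs := lp.hasSum_single (p := 2) (by simp) f
  refine mem_closure_of_tendsto hs (Filter.Eventually.of_forall fun s => ?_)
  refine Submodule.sum_mem _ fun α _ => ?_
  have : lp.single 2 α (f α) = (f α * (√(weight α) : ℂ)) • (monomial α : DASpace d) := by
    unfold monomial
    rw [← lp.single_smul]
    congr 1
    have := (Real.sqrt_pos.2 (weight_pos α)).ne'
    simp [this]
  rw [this]
  exact Submodule.smul_mem _ _ (Submodule.subset_span ⟨α, rfl⟩)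

lemma evalAt_monomial {d : ℕ} (α : Fin d → ℕ) (z : Ball d) :
    evalAt (monomial α) z = ∏ j, (z : EuclideanSpace ℂ (Fin d)) j ^ α j := by
  unfold evalAt
  rw [tsum_eq_single α]
  · have := (Real.sqrt_pos.2 (weight_pos α)).ne'
    simp [monomial, this]
  · intro β hβ
    have h0 : (monomial α : DASpace d) β = 0 := lp.single_apply_ne _ _ _ hβ
    rw [h0, zero_mul, zero_mul]

lemma sum_weight_degree {d : ℕ} (t : Fin d → ℝ) (m : ℕ) :
    ∑ α ∈ Finset.piAntidiag Finset.univ m, weight α * ∏ j, t j ^ α j = (∑ j, t j) ^ m := by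
  rw [Finset.sum_pow_eq_sum_piAntidiag]
  refine Finset.sum_congr rfl fun α hα => ?_
  congr 1
  unfold weight Nat.multinomial
  rw [Nat.cast_div (Nat.prod_factorial_dvd_factorial_sum _ _)]
  exact_mod_cast (Finset.prod_pos fun j _ => Nat.factorial_pos _).ne'

/-- The series that defines the value of `f` at a point of the ball converges absolutely. -/
lemma summable_evalAt {d : ℕ} (f : DASpace d) (z : Ball d) :
    Summable fun α : Fin d → ℕ =>
      f α * (√(weight α) : ℂ) * ∏ j, (z : EuclideanSpace ℂ (Fin d)) j ^ α j := by
  set t : Fin d → ℝ := fun j => ‖(z : EuclideanSpace ℂ (Fin d)) j‖ ^ 2 with ht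
  have hz : ‖(z : EuclideanSpace ℂ (Fin d))‖ < 1 := mem_ball_zero_iff.1 z.2
  have hT : ∑ j, t j < 1 := by
    rw [ht, ← EuclideanSpace.norm_sq_eq]
    exact pow_lt_one₀ (norm_nonneg _) hz two_ne_zero
  have ht0 : ∀ j, 0 ≤ t j := fun j => by positivity
  have hT0 : 0 ≤ ∑ j, t j := Finset.sum_nonneg fun j _ => ht0 j
  have hterm : ∀ α : Fin d → ℕ, 0 ≤ weight α * ∏ j, t j ^ α j := fun α =>
    mul_nonneg (weight_pos α).le (Finset.prod_nonneg fun j _ => pow_nonneg (ht0 j) _)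
  have hw : Summable fun α : Fin d → ℕ => weight α * ∏ j, t j ^ α j := by
    refine summable_of_sum_le (c := ∑' m : ℕ, (∑ j, t j) ^ m) hterm fun s => ?_
    classical
    set D : Finset ℕ := s.image fun α => ∑ j, α j
    calc ∑ α ∈ s, weight α * ∏ j, t j ^ α j
        ≤ ∑ α ∈ D.biUnion fun m => Finset.piAntidiag Finset.univ m, weight α * ∏ j, t j ^ α j := by
          refine Finset.sum_le_sum_of_subset_of_nonneg (fun α hα => ?_) fun α _ _ => hterm α
          simp only [Finset.mem_biUnion, Finset.mem_piAntidiag]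
          exact ⟨∑ j, α j, Finset.mem_image_of_mem _ hα, rfl, fun _ _ => Finset.mem_univ _⟩
      _ = ∑ m ∈ D, (∑ j, t j) ^ m := by
          rw [Finset.sum_biUnion]
          · exact Finset.sum_congr rfl fun m _ => sum_weight_degree t m
          · intro a _ b _ hab
            refine Finset.disjoint_left.2 fun α ha hb => hab ?_
            rw [← (Finset.mem_piAntidiag.1 ha).1, (Finset.mem_piAntidiag.1 hb).1]
      _ ≤ ∑' m : ℕ, (∑ j, t j) ^ m :=
          (summable_geometric_of_lt_one hT0 hT).sum_le_tsum _ fun m _ => pow_nonneg hT0 m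
  have hf : Summable fun α => ‖f α‖ ^ 2 := by
    have := (lp.memℓp f).summable (by norm_num)
    simpa using this
  refine Summable.of_norm_bounded (hf.add hw) fun α => ?_
  have e1 : ‖∏ j, (z : EuclideanSpace ℂ (Fin d)) j ^ α j‖ ^ 2 = ∏ j, t j ^ α j := by
    rw [norm_prod, ← Finset.prod_pow]
    refine Finset.prod_congr rfl fun j _ => ?_
    rw [norm_pow, ht, ← pow_mul, ← pow_mul, mul_comm]
  rw [norm_mul, norm_mul, Complex.norm_real, Real.norm_of_nonneg (Real.sqrt_nonneg _), ← e1]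
  have e2 := Real.sq_sqrt (weight_pos α).le
  nlinarith [sq_nonneg (‖f α‖ - √(weight α) * ‖∏ j, (z : EuclideanSpace ℂ (Fin d)) j ^ α j‖),
    sq_nonneg ‖f α‖, hterm α]

/-! ### Multiplication operators -/

/-- Adding `1` to the `j`-th entry of a multi-index. -/
def incr {d : ℕ} (j : Fin d) (α : Fin d → ℕ) : Fin d → ℕ := α + Pi.single j 1

lemma incr_injective {d : ℕ} (j : Fin d) : Function.Injective (incr j) :=
  fun _ _ h => add_right_cancel h

lemma weight_incr {d : ℕ} (j : Fin d) (α : Fin d → ℕ) :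
    weight (incr j α) = weight α * (((∑ i, α i : ℕ) + 1 : ℝ) / ((α j : ℝ) + 1)) := by
  have h1 : ∑ i, incr j α i = (∑ i, α i) + 1 := by simp [incr, Finset.sum_add_distrib]
  have h2 : ∏ i, (incr j α i).factorial = (α j + 1) * ∏ i, (α i).factorial := by
    rw [← Finset.mul_prod_erase _ _ (Finset.mem_univ j),
      ← Finset.mul_prod_erase _ (fun i => (α i).factorial) (Finset.mem_univ j), ← mul_assoc]
    congr 1
    · simp [incr, Nat.factorial_succ]
    · refine Finset.prod_congr rfl fun i hi => ?_
      simp [incr, Finset.ne_of_mem_erase hi]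
  have h3 : ((∏ i, (α i).factorial : ℕ) : ℝ) ≠ 0 := by
    exact_mod_cast (Finset.prod_pos fun i _ => Nat.factorial_pos _).ne'
  rw [weight, weight, h1, h2, Nat.factorial_succ]
  push_cast at h3 ⊢
  field_simp

/-- The coordinates of `z_j f`: since `z_j z^β = z^{β + e_j}` and
`‖z^{β + e_j}‖² / ‖z^β‖² = (β_j + 1) / (|β| + 1)`, the coordinate at `α` is
`√(α_j / |α|) f_{α - e_j}`, and it is `0` if `α_j = 0`. -/
def shiftCoord {d : ℕ} (j : Fin d) (f : (Fin d → ℕ) → ℂ) (α : Fin d → ℕ) : ℂ :=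
  (√((α j : ℝ) / ((∑ i, α i : ℕ) : ℝ)) : ℂ) * f (α - Pi.single j 1)

lemma mem_range_incr {d : ℕ} (j : Fin d) {α : Fin d → ℕ} (h : α j ≠ 0) :
    α ∈ Set.range (incr j) := by
  refine ⟨α - Pi.single j 1, ?_⟩
  ext i
  by_cases hi : i = j
  · subst hi; simp [incr]; omega
  · simp [incr, hi]

lemma shiftCoord_eq_zero {d : ℕ} (j : Fin d) (f : (Fin d → ℕ) → ℂ) {α : Fin d → ℕ}
    (h : α ∉ Set.range (incr j)) : shiftCoord j f α = 0 := by
  have : α j = 0 := by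
    by_contra h0
    exact h (mem_range_incr j h0)
  simp [shiftCoord, this]

lemma shiftCoord_incr {d : ℕ} (j : Fin d) (f : (Fin d → ℕ) → ℂ) (α : Fin d → ℕ) :
    shiftCoord j f (incr j α) = (√(((α j : ℝ) + 1) / ((∑ i, α i : ℕ) + 1 : ℝ)) : ℂ) * f α := by
  have h1 : incr j α - Pi.single j 1 = α := by simp [incr]
  have h2 : ∑ i, incr j α i = (∑ i, α i) + 1 := by simp [incr, Finset.sum_add_distrib]
  rw [shiftCoord, h1, h2]
  simp [incr]

lemma norm_shiftCoord_incr_le {d : ℕ} (j : Fin d) (f : (Fin d → ℕ) → ℂ) (α : Fin d → ℕ) :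
    ‖shiftCoord j f (incr j α)‖ ≤ ‖f α‖ := by
  rw [shiftCoord_incr, norm_mul]
  refine mul_le_of_le_one_left (norm_nonneg _) ?_
  rw [Complex.norm_real, Real.norm_of_nonneg (Real.sqrt_nonneg _), Real.sqrt_le_one]
  refine div_le_one_of_le₀ ?_ (by positivity)
  have : α j ≤ ∑ i, α i := Finset.single_le_sum (fun i _ => Nat.zero_le _) (Finset.mem_univ j)
  exact_mod_cast Nat.succ_le_succ this

lemma hasSum_shiftCoord {d : ℕ} (j : Fin d) (f : DASpace d) :
    Summable (fun α => ‖shiftCoord j f α‖ ^ 2) ∧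
      ∑' α, ‖shiftCoord j f α‖ ^ 2 ≤ ∑' α, ‖f α‖ ^ 2 := by
  have hf : Summable fun α => ‖f α‖ ^ 2 := by
    have := (lp.memℓp f).summable (by norm_num)
    simpa using this
  have h0 : ∀ α ∉ Set.range (incr j), ‖shiftCoord j f α‖ ^ 2 = 0 := fun α h => by
    simp [shiftCoord_eq_zero j f h]
  have hle : ∀ α, ‖shiftCoord j f (incr j α)‖ ^ 2 ≤ ‖f α‖ ^ 2 := fun α =>
    pow_le_pow_left₀ (norm_nonneg _) (norm_shiftCoord_incr_le j f α) 2
  have hs : Summable fun α => ‖shiftCoord j f (incr j α)‖ ^ 2 :=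
    Summable.of_nonneg_of_le (fun _ => by positivity) hle hf
  refine ⟨((incr_injective j).summable_iff h0).1 hs, ?_⟩
  have hsup : Function.support (fun α => ‖shiftCoord j f α‖ ^ 2) ⊆ Set.range (incr j) := by
    intro α hα
    by_contra h
    exact hα (h0 α h)
  rw [← (incr_injective j).tsum_eq hsup]
  exact hs.tsum_le_tsum hle hf

/-- The operator `M_{z_j}` of multiplication by the `j`-th coordinate, see `evalAt_coordMul`. -/
def coordMul {d : ℕ} (j : Fin d) : DASpace d →L[ℂ] DASpace d :=
  LinearMap.mkContinuous
    { toFun := fun f => ⟨shiftCoord j f, memℓp_gen (by simpa using (hasSum_shiftCoord j f).1)⟩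
      map_add' := fun f g => by
        ext α
        exact mul_add _ _ _
      map_smul' := fun c f => by
        ext α
        exact mul_left_comm _ _ _ } 1
    (fun f => by
      rw [one_mul]
      refine le_of_sq_le_sq ?_ (norm_nonneg _)
      have h := (hasSum_shiftCoord j f).2
      have e : ∀ g : DASpace d, ‖g‖ ^ 2 = ∑' α, ‖g α‖ ^ 2 := fun g => by
        have := lp.norm_rpow_eq_tsum (p := 2) (by norm_num) g
        simpa using this
      rw [e, e]
      exact h)

lemma evalAt_coordMul {d : ℕ} (j : Fin d) (f : DASpace d) (z : Ball d) :
    evalAt (coordMul j f) z = (z : EuclideanSpace ℂ (Fin d)) j * evalAt f z := by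
  unfold evalAt
  have hsup : Function.support (fun α : Fin d → ℕ => coordMul j f α * (√(weight α) : ℂ) *
      ∏ i, (z : EuclideanSpace ℂ (Fin d)) i ^ α i) ⊆ Set.range (incr j) := by
    intro α hα
    by_contra h
    refine hα ?_
    have h0 : coordMul j f α = 0 := shiftCoord_eq_zero j f h
    simp only [h0, zero_mul]
  rw [← (incr_injective j).tsum_eq hsup, ← tsum_mul_left]
  refine tsum_congr fun α => ?_
  have h1 : coordMul j f (incr j α) = _ := shiftCoord_incr j f α
  have h2 : √(((α j : ℝ) + 1) / ((∑ i, α i : ℕ) + 1 : ℝ)) * √(weight (incr j α))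
      = √(weight α) := by
    rw [← Real.sqrt_mul (by positivity), weight_incr]
    congr 1
    field_simp
  have h3 : ∏ i, (z : EuclideanSpace ℂ (Fin d)) i ^ incr j α i =
      (z : EuclideanSpace ℂ (Fin d)) j * ∏ i, (z : EuclideanSpace ℂ (Fin d)) i ^ α i := by
    simp only [incr, Pi.add_apply, pow_add, Finset.prod_mul_distrib]
    rw [mul_comm, Finset.prod_eq_single j (fun i _ hi => by simp [hi]) (by simp)]
    simp
  rw [h1, h3, ← h2, Complex.ofReal_mul]
  ring

/-- The multiplier algebra, as an algebra of operators: all bounded operators `M_φ` of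
multiplication by a function `φ` on the ball. (If `φ g` is in the Drury–Arveson space for all `g`
in it, then `M_φ` is bounded by the closed graph theorem.) -/
def multiplierOperators (d : ℕ) : Set (DASpace d →L[ℂ] DASpace d) :=
  {T | ∃ φ : Ball d → ℂ, ∀ (g : DASpace d) (z : Ball d), evalAt (T g) z = φ z * evalAt g z}

/-! ### The Grassmannian of coinvariant subspaces -/

open ContinuousLinearMap in
/-- The orthogonal projections onto the `n`-dimensional multiplier-coinvariant subspaces,
with the topology of the operator norm. -/
def coinvariantProjections (d n : ℕ) : Set (DASpace d →L[ℂ] DASpace d) :=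
  {P | P ∘L P = P ∧ adjoint P = P ∧
    (∀ M ∈ multiplierOperators d, P ∘L adjoint M ∘L P = adjoint M ∘L P) ∧
    FiniteDimensional ℂ (LinearMap.range (P : DASpace d →ₗ[ℂ] DASpace d)) ∧
    Module.finrank ℂ (LinearMap.range (P : DASpace d →ₗ[ℂ] DASpace d)) = n}

/-- The compressed shift `P M_z|_{P H}`, a `d`-tuple of endomorphisms of the range of `P`. -/
def compressedShift {d : ℕ} (P : DASpace d →L[ℂ] DASpace d) (j : Fin d) :
    Module.End ℂ (LinearMap.range (P : DASpace d →ₗ[ℂ] DASpace d)) :=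
  (P : DASpace d →ₗ[ℂ] DASpace d).rangeRestrict ∘ₗ
    (coordMul j : DASpace d →ₗ[ℂ] DASpace d) ∘ₗ
      (LinearMap.range (P : DASpace d →ₗ[ℂ] DASpace d)).subtype

end DruryArveson

end

/-!
The spectral divisor of `P` in `ℙ_{d,n}` is encoded by the moments `tr (P M_{z^α})`: if it is
`[x_1] + ⋯ + [x_n]`, then the moment of order `α` is `x_1^α + ⋯ + x_n^α`, and these power sums
determine the points up to a permutation, because the characters `α ↦ l^α` of `ℕ^d` for distinct
points `l` are linearly independent.

The joint eigenvalues lie in the ball because each `x_i` is the eigenvalue of a bounded functional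
`Φ` with `Φ(z_j f) = x_{i,j} Φ(f)`, and the Taylor coefficients of its Riesz vector are square
summable only if `‖x_i‖ < 1`. For surjectivity one enlarges a co-invariant space `V` by one vector:
for a point `z` of the ball, the leading coefficient at `z` along a complex line, restricted to
`Vᗮ`, is a nonzero bounded functional on which each multiplier `φ` acts by `φ z`. Finally the
moments depend continuously on `P`, since `(P - Q) M_{z^α}` has rank at most `2n`, and compactness
of the closed polyball turns convergence of moments into convergence of points.
-/

noncomputable section

namespace DruryArveson

section Tuples

variable {ι X : Type*}

lemma sum_boole_eq_card_fiber {R : Type*} [Fintype ι] [AddCommMonoidWithOne R] [DecidableEq X]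
    (x : ι → X) (l : X) :
    ∑ i, (if x i = l then (1 : R) else 0) = (Nat.card {i // x i = l} : R) := by
  rw [Finset.sum_boole, Nat.card_eq_fintype_card, Fintype.card_subtype]

lemma exists_perm_of_card_fiber_eq [Finite ι] {x y : ι → X}
    (h : ∀ l, Nat.card {i // x i = l} = Nat.card {i // y i = l}) :
    ∃ s : Equiv.Perm ι, y = x ∘ s := by
  have e : ∀ l, {i // y i = l} ≃ {i // x i = l} := fun l =>
    (Finite.card_eq.1 (h l).symm).some
  refine ⟨(Equiv.sigmaFiberEquiv y).symm.trans
    ((Equiv.sigmaCongrRight e).trans (Equiv.sigmaFiberEquiv x)), funext fun i => ?_⟩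
  exact (e (y i) ⟨i, rfl⟩).2.symm

lemma exists_tuple_sum_eq {n : ℕ} (c : X →₀ ℕ) (hc : c.sum (fun _ m => m) = n) :
    ∃ x : Fin n → X, ∀ {M : Type} [AddCommMonoid M] (f : X → M),
      ∑ i, f (x i) = c.sum fun l m => m • f l := by
  have hcard : Fintype.card (Fin n) = Fintype.card (Σ l : c.support, Fin (c l)) := by
    rw [Fintype.card_fin, Fintype.card_sigma, ← hc, Finsupp.sum, ← Finset.sum_coe_sort]
    simp only [Fintype.card_fin]
  let e := Fintype.equivOfCardEq hcard
  refine ⟨fun i => (e i).1, fun f => ?_⟩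
  rw [e.sum_comp fun p => f p.1, Fintype.sum_sigma]
  simp only [Finset.sum_const, Finset.card_univ, Fintype.card_fin]
  exact Finset.sum_coe_sort c.support fun l => c l • f l

variable {κ K : Type*} [Fintype κ] [CommRing K] [IsDomain K]

lemma linearIndependent_monomialEval :
    LinearIndependent K fun (l : κ → K) (α : κ → ℕ) => ∏ j, l j ^ α j := by
  let ψ (l : κ → K) : Multiplicative (κ → ℕ) →* K :=
    { toFun := fun α => ∏ j, l j ^ α.toAdd j
      map_one' := by simp
      map_mul' := fun α β => by simp [pow_add, Finset.prod_mul_distrib] }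
  have hψ : Function.Injective ψ := fun l m h => funext fun j => by
    classical
    simpa [ψ, Finset.prod_pow_eq_pow_sum, Pi.single_apply, pow_ite] using
      DFunLike.congr_fun h (Multiplicative.ofAdd (Pi.single j 1))
  exact (linearIndependent_monoidHom (Multiplicative (κ → ℕ)) K).comp ψ hψ

lemma card_fiber_eq_of_moments_eq [Fintype ι] [CharZero K] {x y : ι → κ → K}
    (h : ∀ α : κ → ℕ, ∑ i, ∏ j, x i j ^ α j = ∑ i, ∏ j, y i j ^ α j) (l : κ → K) :
    Nat.card {i // x i = l} = Nat.card {i // y i = l} := by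
  classical
  let count (x : ι → κ → K) : (κ → K) →₀ K := ∑ i, Finsupp.single (x i) 1
  have hcount : ∀ x, count x l = Nat.card {i // x i = l} := fun x => by
    simp only [count, Finsupp.finsetSum_apply, Finsupp.single_apply, sum_boole_eq_card_fiber]
  have hxy : count x = count y := linearIndependent_monomialEval <| funext fun α => by
    simpa [count, map_sum, Finsupp.linearCombination_single, Finset.sum_apply] using h α
  exact_mod_cast (hcount x).symm.trans ((congrArg (· l) hxy).trans (hcount y))

end Tuples

open Module.End Set

section GeneralizedEigenspaces

variable {K V : Type*} [Field K] [AddCommGroup V] [Module K V]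

lemma maxGenEigenspace_inf_le_mul {f g : Module.End K V} (h : Commute f g) (μ ν : K) :
    f.maxGenEigenspace μ ⊓ g.maxGenEigenspace ν ≤ (f * g).maxGenEigenspace (μ * ν) := by
  have hN : Commute (f - μ • 1) g := h.sub_left (Algebra.commute_algebraMap_left μ g)
  have hsplit : f * g = (f - μ • 1) * g + μ • g := by simp [sub_mul]
  have hle : f.maxGenEigenspace μ ≤ ((f - μ • 1) * g).maxGenEigenspace 0 := fun v hv => by
    obtain ⟨k, hk⟩ := (mem_maxGenEigenspace _ _ _).1 hv
    refine (mem_maxGenEigenspace _ _ _).2 ⟨k, ?_⟩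
    rw [zero_smul, sub_zero, hN.mul_pow, (hN.pow_pow k k).eq, mul_apply, hk, map_zero]
  rw [hsplit, ← zero_add (μ * ν)]
  exact (inf_le_inf hle (genEigenspace_le_smul g ν μ ⊤)).trans
    (genEigenspace_inf_le_add _ _ _ _ ⊤ ⊤ ((hN.mul_left (.refl g)).smul_right μ))

lemma maxGenEigenspace_le_pow (f : Module.End K V) (μ : K) (k : ℕ) :
    f.maxGenEigenspace μ ≤ (f ^ k).maxGenEigenspace (μ ^ k) := by
  induction k with
  | zero => exact fun v _ => (mem_maxGenEigenspace _ _ _).2 ⟨1, by simp⟩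
  | succ k ih =>
    rw [pow_succ, pow_succ]
    exact (le_inf ih le_rfl).trans (maxGenEigenspace_inf_le_mul (.pow_left (.refl f) k) _ _)

lemma trace_restrict_eq_of_le_maxGenEigenspace [FiniteDimensional K V] {f : Module.End K V}
    {μ : K} {W : Submodule K V} (hW : W ≤ f.maxGenEigenspace μ) (hf : MapsTo f W W) :
    LinearMap.trace K W (f.restrict hf) = Module.finrank K W * μ := by
  have hmaps : MapsTo (f - algebraMap K (Module.End K V) μ) W W := fun v hv =>
    W.sub_mem (hf hv) (W.smul_mem μ hv)
  have hnil : IsNilpotent (f.restrict hf - algebraMap K (Module.End K W) μ) :=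
    isNilpotent_restrict_of_le (hp := hmaps) hW
      (isNilpotent_restrict_maxGenEigenspace_sub_algebraMap f μ)
  simpa [one_eq_id, mul_comm] using
    LinearMap.trace_comp_eq_mul_of_commute_of_isNilpotent μ (.one_left (f.restrict hf)) hnil

/-- The joint generalized eigenspace of a tuple of endomorphisms. -/
def jointGenEigenspace {κ : Type*} (A : κ → Module.End K V) (l : κ → K) : Submodule K V :=
  ⨅ j, (A j).maxGenEigenspace (l j)

variable {κ : Type*} {A : κ → Module.End K V}

lemma jointGenEigenspace_le (A : κ → Module.End K V) (l : κ → K) (j : κ) :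
    jointGenEigenspace A l ≤ (A j).maxGenEigenspace (l j) :=
  iInf_le (fun j => (A j).maxGenEigenspace (l j)) j

lemma mapsTo_jointGenEigenspace {B : Module.End K V} (hB : ∀ j, Commute (A j) B) (l : κ → K) :
    MapsTo B (jointGenEigenspace A l) (jointGenEigenspace A l) := fun v hv => by
  simp only [jointGenEigenspace, SetLike.mem_coe, Submodule.mem_iInf] at hv ⊢
  exact fun j => mapsTo_maxGenEigenspace_of_comm (hB j) (l j) (hv j)

lemma iSupIndep_jointGenEigenspace (hA : ∀ i j, Commute (A i) (A j)) :
    iSupIndep (jointGenEigenspace A) :=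
  independent_iInf_maxGenEigenspace_of_forall_mapsTo A fun i j =>
    mapsTo_maxGenEigenspace_of_comm (hA j i)

lemma isInternal_jointGenEigenspace [IsAlgClosed K] [FiniteDimensional K V]
    [DecidableEq (κ → K)] (hA : ∀ i j, Commute (A i) (A j)) :
    DirectSum.IsInternal (jointGenEigenspace A) :=
  DirectSum.isInternal_submodule_of_iSupIndep_of_iSup_eq_top (iSupIndep_jointGenEigenspace hA)
    (iSup_iInf_maxGenEigenspace_eq_top_of_forall_mapsTo A
      (fun i j => mapsTo_maxGenEigenspace_of_comm (hA j i))
      fun j => iSup_maxGenEigenspace_eq_top (A j))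

end GeneralizedEigenspaces

section CommutingTuples

variable {d : ℕ} {V W : Type*} [AddCommGroup V] [Module ℂ V] [AddCommGroup W] [Module ℂ W]

lemma tuplePow_succ (A : Fin (d + 1) → Module.End ℂ V) (α : Fin (d + 1) → ℕ) :
    tuplePow A α = A 0 ^ α 0 * tuplePow (fun j => A j.succ) fun j => α j.succ := by
  simp [tuplePow, List.ofFn_succ]

lemma tuplePow_zero (A : Fin d → Module.End ℂ V) : tuplePow A 0 = 1 := by
  simp [tuplePow]

lemma tuplePow_single (A : Fin d → Module.End ℂ V) (j : Fin d) (k : ℕ) :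
    tuplePow A (Pi.single j k) = A j ^ k := by
  induction d with
  | zero => exact j.elim0
  | succ d ih =>
    rw [tuplePow_succ]
    cases j using Fin.cases with
    | zero =>
      have htail : (fun i : Fin d => (Pi.single 0 k : Fin (d + 1) → ℕ) i.succ) = 0 := by
        ext i; simp
      rw [htail, tuplePow_zero, Pi.single_eq_same, mul_one]
    | succ j =>
      have htail : (fun i : Fin d => (Pi.single j.succ k : Fin (d + 1) → ℕ) i.succ) =
          Pi.single j k := by
        ext i; simp [Pi.single_apply, Fin.succ_inj]
      rw [htail, ih, Pi.single_eq_of_ne (Fin.succ_ne_zero j).symm, pow_zero, one_mul]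

lemma comp_tuplePow {S : V →ₗ[ℂ] W} {A : Fin d → Module.End ℂ V} {B : Fin d → Module.End ℂ W}
    (h : ∀ j, S ∘ₗ A j = B j ∘ₗ S) (α : Fin d → ℕ) :
    S ∘ₗ tuplePow A α = tuplePow B α ∘ₗ S := by
  induction d with
  | zero => simp [tuplePow, one_eq_id]
  | succ d ih =>
    rw [tuplePow_succ, tuplePow_succ, mul_eq_comp, mul_eq_comp, ← LinearMap.comp_assoc,
      ← commute_pow_left_of_commute (h 0).symm, LinearMap.comp_assoc, ih fun j => h j.succ,
      LinearMap.comp_assoc]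

lemma commute_tuplePow {A : Fin d → Module.End ℂ V} {B : Module.End ℂ V}
    (h : ∀ j, Commute B (A j)) (α : Fin d → ℕ) : Commute B (tuplePow A α) :=
  comp_tuplePow (fun j => (h j).eq) α

lemma jointGenEigenspace_le_tuplePow {A : Fin d → Module.End ℂ V}
    (hA : ∀ i j, Commute (A i) (A j)) (l : Fin d → ℂ) (α : Fin d → ℕ) :
    jointGenEigenspace A l ≤ (tuplePow A α).maxGenEigenspace (∏ j, l j ^ α j) := by
  induction d with
  | zero => exact fun v _ => (mem_maxGenEigenspace _ _ _).2 ⟨1, by simp [tuplePow]⟩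
  | succ d ih =>
    rw [tuplePow_succ, Fin.prod_univ_succ]
    have hhead : jointGenEigenspace A l ≤ (A 0 ^ α 0).maxGenEigenspace (l 0 ^ α 0) :=
      (jointGenEigenspace_le A l 0).trans (maxGenEigenspace_le_pow _ _ _)
    have htail : jointGenEigenspace A l ≤
        jointGenEigenspace (fun j : Fin d => A j.succ) (fun j => l j.succ) :=
      le_iInf fun j : Fin d => jointGenEigenspace_le A l j.succ
    replace htail := htail.trans
      (ih (fun i j => hA i.succ j.succ) (fun j => l j.succ) fun j => α j.succ)
    exact (le_inf hhead htail).trans (maxGenEigenspace_inf_le_mul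
      (commute_tuplePow (fun j => (hA 0 j.succ).pow_left _) _) _ _)

lemma exists_trace_tuplePow_eq_sum [FiniteDimensional ℂ V] {A : Fin d → Module.End ℂ V}
    (hA : ∀ i j, Commute (A i) (A j)) :
    ∃ c : (Fin d → ℂ) →₀ ℕ, (∀ l, c l = Module.finrank ℂ (jointGenEigenspace A l)) ∧
      ∀ α, LinearMap.trace ℂ V (tuplePow A α) = c.sum fun l m => m • ∏ j, l j ^ α j := by
  classical
  have hfin : {l | jointGenEigenspace A l ≠ ⊥}.Finite :=
    WellFoundedGT.finite_ne_bot_of_iSupIndep (iSupIndep_jointGenEigenspace hA)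
  refine ⟨Finsupp.onFinset hfin.toFinset (fun l => Module.finrank ℂ (jointGenEigenspace A l))
    fun l hl => ?_, fun l => rfl, fun α => ?_⟩
  · simpa [Submodule.finrank_eq_zero] using hl
  · rw [Finsupp.onFinset_sum _ (by simp),
      LinearMap.trace_eq_sum_trace_restrict' (isInternal_jointGenEigenspace hA) hfin
        (mapsTo_jointGenEigenspace fun j => commute_tuplePow (hA j) α)]
    refine Finset.sum_congr rfl fun l _ => ?_
    rw [trace_restrict_eq_of_le_maxGenEigenspace (jointGenEigenspace_le_tuplePow hA l α),
      nsmul_eq_mul]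

end CommutingTuples

section NilpotentMaps

variable {K V : Type*} [Field K] [AddCommGroup V] [Module K V]

lemma maxGenEigenspace_sub_smul_one (f : Module.End K V) (μ : K) :
    (f - μ • 1).maxGenEigenspace 0 = f.maxGenEigenspace μ := by
  ext v
  simp only [mem_maxGenEigenspace, zero_smul, sub_zero]

lemma inf_ker_ne_bot {N : Module.End K V} {U : Submodule K V} (hN : MapsTo N U U)
    (hnil : U ≤ N.maxGenEigenspace 0) (hU : U ≠ ⊥) : U ⊓ LinearMap.ker N ≠ ⊥ := by
  intro hbot
  have hinj : ∀ k : ℕ, ∀ v ∈ U, (N ^ k) v = 0 → v = 0 := by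
    intro k
    induction k with
    | zero => exact fun v _ hv => hv
    | succ k ih =>
      intro v hv hNv
      have hv0 : v ∈ U ⊓ LinearMap.ker N := ⟨hv, ih (N v) (hN hv) (by rwa [pow_succ] at hNv)⟩
      rwa [hbot, Submodule.mem_bot] at hv0
  refine hU ((Submodule.eq_bot_iff U).2 fun v hv => ?_)
  obtain ⟨k, hk⟩ := (mem_maxGenEigenspace N 0 v).1 (hnil hv)
  exact hinj k v hv (by simpa using hk)

lemma finrank_map_le_sub_one [FiniteDimensional K V] {N : Module.End K V} {U : Submodule K V}
    (hN : MapsTo N U U) (hnil : U ≤ N.maxGenEigenspace 0) :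
    Module.finrank K (U.map N) ≤ Module.finrank K U - 1 := by
  rcases eq_or_ne U ⊥ with rfl | hU
  · simp
  have hker : LinearMap.ker (N.domRestrict U) ≠ ⊥ := fun h => inf_ker_ne_bot hN hnil hU <| by
    rwa [LinearMap.ker_domRestrict, ← Submodule.disjoint_iff_comap_eq_bot, disjoint_iff] at h
  have hpos := (Submodule.one_le_finrank_iff (S := LinearMap.ker (N.domRestrict U))).2 hker
  have hsum := LinearMap.finrank_range_add_finrank_ker (N.domRestrict U)
  rw [LinearMap.range_domRestrict] at hsum
  omega

lemma finrank_map_pow_le_sub [FiniteDimensional K V] {N : Module.End K V} {U : Submodule K V}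
    (hN : MapsTo N U U) (hnil : U ≤ N.maxGenEigenspace 0) (k : ℕ) :
    Module.finrank K (U.map (N ^ k)) ≤ Module.finrank K U - k := by
  induction k with
  | zero => rw [pow_zero, one_eq_id, Submodule.map_id, Nat.sub_zero]
  | succ k ih =>
    have hle : U.map (N ^ k) ≤ U := Submodule.map_le_iff_le_comap.2 fun v hv => by
      rw [Submodule.mem_comap, pow_apply]; exact hN.iterate k hv
    have hmaps : MapsTo N (U.map (N ^ k)) (U.map (N ^ k)) := by
      rintro _ ⟨v, hv, rfl⟩
      exact ⟨N v, hN hv, by rw [← mul_apply, ← mul_apply, (Commute.pow_self N k).eq]⟩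
    rw [pow_succ', mul_eq_comp, Submodule.map_comp]
    have := finrank_map_le_sub_one hmaps (hle.trans hnil)
    omega

end NilpotentMaps

section JointSpectrum

variable {d : ℕ} {V : Type*} [AddCommGroup V] [Module ℂ V]
  {A : Fin d → Module.End ℂ V}

lemma finrank_map_tuplePow_le [FiniteDimensional ℂ V] (hA : ∀ i j, Commute (A i) (A j))
    {U : Submodule ℂ V} (hU : ∀ j, MapsTo (A j) U U)
    (hnil : ∀ j, U ≤ (A j).maxGenEigenspace 0) (α : Fin d → ℕ) :
    Module.finrank ℂ (U.map (tuplePow A α)) ≤ Module.finrank ℂ U - ∑ j, α j := by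
  induction d with
  | zero =>
    rw [Subsingleton.elim α 0, tuplePow_zero, one_eq_id, Submodule.map_id]
    simp
  | succ d ih =>
    set T := tuplePow (fun j => A j.succ) fun j => α j.succ with hT
    have hcomm : Commute (A 0) T := commute_tuplePow (fun j => hA 0 j.succ) _
    have hmaps : MapsTo (A 0) (U.map T) (U.map T) := by
      rintro _ ⟨v, hv, rfl⟩
      exact ⟨A 0 v, hU 0 hv, LinearMap.congr_fun hcomm.eq.symm v⟩
    have hle : U.map T ≤ (A 0).maxGenEigenspace 0 := by
      rintro _ ⟨v, hv, rfl⟩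
      exact mapsTo_maxGenEigenspace_of_comm hcomm 0 (hnil 0 hv)
    have htail := ih (fun i j => hA i.succ j.succ) (fun j => hU j.succ) (fun j => hnil j.succ)
      fun j => α j.succ
    rw [← hT] at htail
    have hhead := finrank_map_pow_le_sub hmaps hle (α 0)
    rw [tuplePow_succ, ← hT, mul_eq_comp, Submodule.map_comp, Fin.sum_univ_succ]
    omega

lemma commute_sub_smul_one (hA : ∀ i j, Commute (A i) (A j)) (l : EuclideanSpace ℂ (Fin d))
    (i j : Fin d) : Commute (A i) (A j - l j • 1) :=
  (hA i j).sub_right (Algebra.commute_algebraMap_right (l j) (A i))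

lemma mem_jointSpectrum_of_jointGenEigenspace_ne_bot (hA : ∀ i j, Commute (A i) (A j))
    (l : EuclideanSpace ℂ (Fin d)) (hl : jointGenEigenspace A l.ofLp ≠ ⊥) :
    l ∈ jointSpectrum A := by
  have hinf : ∀ s : Finset (Fin d), jointGenEigenspace A l.ofLp ⊓
      ⨅ j ∈ s, LinearMap.ker (A j - l j • (1 : Module.End ℂ V)) ≠ ⊥ := by
    intro s
    induction s using Finset.cons_induction with
    | empty => simpa using hl
    | cons i s _ ih =>
      rw [Finset.cons_eq_insert, Finset.iInf_insert, inf_comm (LinearMap.ker _), ← inf_assoc]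
      refine inf_ker_ne_bot (fun v hv => ⟨mapsTo_jointGenEigenspace
        (fun j => commute_sub_smul_one hA l j i) _ hv.1, ?_⟩) ?_ ih
      · have hker := hv.2
        simp only [SetLike.mem_coe, Submodule.mem_iInf, LinearMap.mem_ker] at hker ⊢
        intro j hj
        have hcomm := (commute_sub_smul_one hA l i j).sub_left
          (Algebra.commute_algebraMap_left (l i) (A j - l j • 1))
        exact (LinearMap.congr_fun hcomm.eq v).symm.trans (by simp [hker j hj])
      · rw [maxGenEigenspace_sub_smul_one]
        exact inf_le_left.trans (jointGenEigenspace_le A _ i)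
  intro hbot
  simpa [hbot] using hinf Finset.univ

variable [FiniteDimensional ℂ V]

lemma rootSubspace_eq_jointGenEigenspace (hA : ∀ i j, Commute (A i) (A j))
    (l : EuclideanSpace ℂ (Fin d)) : rootSubspace A l = jointGenEigenspace A l.ofLp := by
  refine le_antisymm (fun v hv => ?_) (le_iInf fun α => ?_)
  · simp only [rootSubspace, jointGenEigenspace, Submodule.mem_iInf, Subtype.forall,
      LinearMap.mem_ker, mem_maxGenEigenspace] at hv ⊢
    refine fun j => ⟨Module.finrank ℂ V, ?_⟩
    have := hv (Pi.single j (Module.finrank ℂ V)) (by simp)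
    rwa [tuplePow_single] at this
  · have hcomm := commute_sub_smul_one hA l
    have hdim := finrank_map_tuplePow_le (A := fun j => A j - l j • 1)
      (fun i j => (hcomm i j).sub_left (Algebra.commute_algebraMap_left (l i) _))
      (U := jointGenEigenspace A l.ofLp) (fun j => mapsTo_jointGenEigenspace (hcomm · j) _)
      (fun j => (jointGenEigenspace_le A _ j).trans_eq (maxGenEigenspace_sub_smul_one _ _).symm) α
    rw [α.2, Nat.sub_eq_zero_of_le (Submodule.finrank_le _), Nat.le_zero,
      Submodule.finrank_eq_zero] at hdim
    exact LinearMap.le_ker_iff_map.2 hdim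

lemma jointSpectrumMult_eq_finrank (hA : ∀ i j, Commute (A i) (A j))
    (l : EuclideanSpace ℂ (Fin d)) :
    jointSpectrumMult A l = Module.finrank ℂ (jointGenEigenspace A l.ofLp) := by
  rw [jointSpectrumMult]
  split_ifs with hl
  · rw [rootSubspace_eq_jointGenEigenspace hA]
  · rw [not_imp_comm.1 (mem_jointSpectrum_of_jointGenEigenspace_ne_bot hA l) hl, finrank_bot]

end JointSpectrum

section SpectralTuples

variable {d n : ℕ} {V : Type*} [AddCommGroup V] [Module ℂ V] {A : Fin d → Module.End ℂ V}

/-- The points `x_1, …, x_n` enumerate the joint spectrum of the tuple `A` with multiplicities,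
that is, `σ_J(A) = [x_1] + … + [x_n]`. -/
def IsSpectralTuple (A : Fin d → Module.End ℂ V) (x : Fin n → EuclideanSpace ℂ (Fin d)) : Prop :=
  ∀ l, Nat.card {i // x i = l} = jointSpectrumMult A l

lemma IsSpectralTuple.mem_jointSpectrum {x : Fin n → EuclideanSpace ℂ (Fin d)}
    (hx : IsSpectralTuple A x) (i : Fin n) : x i ∈ jointSpectrum A := by
  by_contra hi
  have hcard := hx (x i)
  rw [jointSpectrumMult, if_neg hi, Finite.card_eq_zero_iff] at hcard
  exact hcard.elim ⟨i, rfl⟩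

lemma tuplePow_dualMap (hA : ∀ i j, Commute (A i) (A j)) (α : Fin d → ℕ) :
    tuplePow (fun j => (A j).dualMap) α = (tuplePow A α).dualMap := by
  have hmul (f g : Module.End ℂ V) : (f * g).dualMap = g.dualMap * f.dualMap :=
    LinearMap.dualMap_comp_dualMap g f
  have hpow (f : Module.End ℂ V) (k : ℕ) : (f ^ k).dualMap = f.dualMap ^ k := by
    induction k with
    | zero => exact LinearMap.dualMap_id
    | succ k ih => rw [pow_succ, hmul, ih, pow_succ']
  induction d with
  | zero => exact LinearMap.dualMap_id.symm
  | succ d ih =>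
    have hcomm := commute_tuplePow (fun j => (hA 0 (Fin.succ j)).pow_left (α 0)) fun j => α j.succ
    rw [tuplePow_succ, tuplePow_succ, ih fun i j => hA i.succ j.succ, ← hpow, ← hmul, hcomm.eq]

variable [FiniteDimensional ℂ V]

lemma exists_isSpectralTuple_trace_eq (hA : ∀ i j, Commute (A i) (A j))
    (hn : Module.finrank ℂ V = n) :
    ∃ x : Fin n → EuclideanSpace ℂ (Fin d), IsSpectralTuple A x ∧
      ∀ α, LinearMap.trace ℂ V (tuplePow A α) = ∑ i, ∏ j, x i j ^ α j := by
  classical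
  obtain ⟨c, hc, htrace⟩ := exists_trace_tuplePow_eq_sum hA
  have hcard : c.sum (fun _ m => m) = n := by
    have h0 := htrace 0
    rw [tuplePow_zero, LinearMap.trace_one, hn] at h0
    exact_mod_cast (by simpa [Finsupp.sum] using h0.symm : ((c.sum fun _ m => m : ℕ) : ℂ) = n)
  obtain ⟨x, hx⟩ := exists_tuple_sum_eq c hcard
  refine ⟨fun i => WithLp.toLp 2 (x i), fun l => ?_, fun α => ?_⟩
  · have hcount := hx fun p => if WithLp.toLp 2 p = l then (1 : ℕ) else 0
    rw [sum_boole_eq_card_fiber fun i => WithLp.toLp 2 (x i)] at hcount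
    rw [jointSpectrumMult_eq_finrank hA, ← hc]
    simpa only [WithLp.ext_iff, smul_eq_mul, mul_boole, Finsupp.sum_ite_self_eq', Nat.cast_id]
      using hcount
  · rw [htrace, hx fun p => ∏ j, p j ^ α j]

lemma isSpectralTuple_iff_trace (hA : ∀ i j, Commute (A i) (A j)) (hn : Module.finrank ℂ V = n)
    {x : Fin n → EuclideanSpace ℂ (Fin d)} :
    IsSpectralTuple A x ↔
      ∀ α, LinearMap.trace ℂ V (tuplePow A α) = ∑ i, ∏ j, x i j ^ α j := by
  obtain ⟨y, hy, htrace⟩ := exists_isSpectralTuple_trace_eq hA hn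
  constructor
  · intro hx α
    obtain ⟨s, rfl⟩ := exists_perm_of_card_fiber_eq fun l => (hy l).trans (hx l).symm
    exact (htrace α).trans (Equiv.sum_comp s fun i => ∏ j, y i j ^ α j).symm
  · intro hx l
    rw [← hy l]
    have hmoments : ∀ α : Fin d → ℕ, ∑ i, ∏ j, (x i).ofLp j ^ α j = ∑ i, ∏ j, (y i).ofLp j ^ α j :=
      fun α => (hx α).symm.trans (htrace α)
    simpa only [WithLp.ext_iff] using card_fiber_eq_of_moments_eq hmoments l.ofLp

lemma IsSpectralTuple.exists_dual_eigenvector (hA : ∀ i j, Commute (A i) (A j))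
    {x : Fin n → EuclideanSpace ℂ (Fin d)} (hx : IsSpectralTuple A x)
    (hn : Module.finrank ℂ V = n) (i : Fin n) :
    ∃ χ : Module.Dual ℂ V, χ ≠ 0 ∧ ∀ j v, χ (A j v) = x i j * χ v := by
  have hdual : ∀ i j, Commute (A i).dualMap (A j).dualMap := fun i j =>
    (congrArg LinearMap.dualMap (hA j i).eq :)
  have hx' : IsSpectralTuple (fun j => (A j).dualMap) x :=
    (isSpectralTuple_iff_trace hdual (Subspace.dual_finrank_eq.trans hn)).2 fun α => by
      rw [← (isSpectralTuple_iff_trace hA hn).1 hx, tuplePow_dualMap hA]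
      exact LinearMap.trace_transpose' _
  obtain ⟨χ, hχ, hχ0⟩ := Submodule.exists_mem_ne_zero_of_ne_bot (hx'.mem_jointSpectrum i)
  refine ⟨χ, hχ0, fun j v => ?_⟩
  have hker := LinearMap.mem_ker.1 ((Submodule.mem_iInf _).1 hχ j)
  simpa [sub_eq_zero] using LinearMap.congr_fun hker v

end SpectralTuples

section RangeTrace

variable {K V : Type*} [Field K] [AddCommGroup V] [Module K V]

/-- The trace of an endomorphism of finite rank of a possibly infinite-dimensional space,
defined as the trace of its restriction to its range. It is `0` if the range is
infinite-dimensional. -/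
def rangeTrace (F : Module.End K V) : K :=
  LinearMap.trace K (LinearMap.range F) (F.restrict fun v _ => LinearMap.mem_range_self F v)

variable {F G : Module.End K V}

lemma rangeTrace_eq_trace_restrict {W : Submodule K V} [FiniteDimensional K W]
    (hF : ∀ v, F v ∈ W) : rangeTrace F = LinearMap.trace K W (F.restrict fun v _ => hF v) := by
  have hle : LinearMap.range F ≤ W := by
    rintro _ ⟨v, rfl⟩
    exact hF v
  have : FiniteDimensional K (LinearMap.range F) := Submodule.finiteDimensional_of_le hle
  exact LinearMap.trace_comp_comm' (Submodule.inclusion hle) (F.rangeRestrict ∘ₗ W.subtype)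

lemma rangeTrace_zero : rangeTrace (0 : Module.End K V) = 0 := map_zero (LinearMap.trace K _)

lemma rangeTrace_add {W₁ W₂ : Submodule K V} [FiniteDimensional K W₁] [FiniteDimensional K W₂]
    (hF : ∀ v, F v ∈ W₁) (hG : ∀ v, G v ∈ W₂) :
    rangeTrace (F + G) = rangeTrace F + rangeTrace G := by
  have hF' (v : V) : F v ∈ W₁ ⊔ W₂ := Submodule.mem_sup_left (hF v)
  have hG' (v : V) : G v ∈ W₁ ⊔ W₂ := Submodule.mem_sup_right (hG v)
  rw [rangeTrace_eq_trace_restrict hF', rangeTrace_eq_trace_restrict hG',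
    rangeTrace_eq_trace_restrict fun v => add_mem (hF' v) (hG' v), ← map_add]
  rfl

lemma norm_rangeTrace_le {𝕜 H : Type*} [RCLike 𝕜] [NormedAddCommGroup H] [InnerProductSpace 𝕜 H]
    {W : Submodule 𝕜 H} [FiniteDimensional 𝕜 W] {F : H →L[𝕜] H} (hF : ∀ v, F v ∈ W) :
    ‖rangeTrace (F : Module.End 𝕜 H)‖ ≤ Module.finrank 𝕜 W * ‖F‖ := by
  rw [rangeTrace_eq_trace_restrict hF, LinearMap.trace_eq_sum_inner _ (stdOrthonormalBasis 𝕜 W)]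
  have hb (i) : ‖stdOrthonormalBasis 𝕜 W i‖ = 1 := (stdOrthonormalBasis 𝕜 W).norm_eq_one i
  refine (norm_sum_le_of_le (f := fun i => _) (n := fun _ => ‖F‖) _ fun i _ => ?_).trans (by simp)
  refine (norm_inner_le_norm _ _).trans ?_
  rw [hb, one_mul]
  exact F.le_of_opNorm_le_of_le le_rfl (hb i).le |>.trans (mul_one _).le

lemma norm_rangeTrace_comp_sub_le {𝕜 H : Type*} [RCLike 𝕜] [NormedAddCommGroup H]
    [InnerProductSpace 𝕜 H] (A B T : H →L[𝕜] H)
    [FiniteDimensional 𝕜 (LinearMap.range A.toLinearMap)]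
    [FiniteDimensional 𝕜 (LinearMap.range B.toLinearMap)] :
    ‖rangeTrace (A ∘L T).toLinearMap - rangeTrace (B ∘L T).toLinearMap‖ ≤
      (Module.finrank 𝕜 (LinearMap.range A.toLinearMap) +
        Module.finrank 𝕜 (LinearMap.range B.toLinearMap)) * (‖A - B‖ * ‖T‖) := by
  set W := LinearMap.range A.toLinearMap ⊔ LinearMap.range B.toLinearMap
  have hmem (v : H) : ((A - B) ∘L T) v ∈ W :=
    sub_mem (Submodule.mem_sup_left ⟨T v, rfl⟩) (Submodule.mem_sup_right ⟨T v, rfl⟩)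
  have hsub : rangeTrace (A ∘L T).toLinearMap =
      rangeTrace ((A - B) ∘L T).toLinearMap + rangeTrace (B ∘L T).toLinearMap := by
    rw [← rangeTrace_add hmem fun v => LinearMap.mem_range_self B.toLinearMap (T v),
      ← ContinuousLinearMap.toLinearMap_add, ← ContinuousLinearMap.add_comp, sub_add_cancel]
  rw [hsub, add_sub_cancel_right]
  refine (norm_rangeTrace_le hmem).trans ?_
  gcongr
  · exact_mod_cast Submodule.finrank_add_le_finrank_add_finrank _ _
  · exact ContinuousLinearMap.opNorm_comp_le _ _

end RangeTrace

open Filter Topology ContinuousLinearMap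

section Multipliers

variable {d : ℕ}

/-- Evaluation at a point of the ball, as a bounded functional. -/
def evalCLM (z : Ball d) : DASpace d →L[ℂ] ℂ :=
  continuousLinearMapOfTendsto
    (fun s : Finset (Fin d → ℕ) => ∑ α ∈ s, ((√(weight α) : ℂ) *
      ∏ j, (z : EuclideanSpace ℂ (Fin d)) j ^ α j) • lp.evalCLM ℂ (fun _ => ℂ) 2 α)
    (f := fun f => evalAt f z) (l := atTop) <| tendsto_pi_nhds.2 fun f => by
      refine (summable_evalAt f z).hasSum.congr fun s => ?_
      rw [sum_apply]
      exact Finset.sum_congr rfl fun α _ => (mul_assoc _ _ _).trans (mul_comm _ _)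

/-- `T` is the operator `M_φ` of multiplication by `φ`. -/
def IsMultiplicationBy (T : DASpace d →L[ℂ] DASpace d) (φ : Ball d → ℂ) : Prop :=
  ∀ (g : DASpace d) (z : Ball d), evalAt (T g) z = φ z * evalAt g z

lemma coordMul_monomial (j : Fin d) (α : Fin d → ℕ) :
    coordMul j (monomial α) = monomial (incr j α) := by
  ext β
  by_cases hβ : β ∈ range (incr j)
  · obtain ⟨γ, rfl⟩ := hβ
    refine (shiftCoord_incr j (monomial α) γ).trans ?_
    by_cases hγ : γ = α
    · subst hγ
      rw [monomial, monomial, lp.single_apply_self, lp.single_apply_self, weight_incr,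
        ← Complex.ofReal_mul, ← Real.sqrt_inv, ← Real.sqrt_inv, ← Real.sqrt_mul (by positivity)]
      congr 2
      have := (weight_pos γ).ne'
      field_simp
    · rw [monomial, monomial, lp.single_apply_ne _ _ _ hγ,
        lp.single_apply_ne _ _ _ ((incr_injective j).ne hγ), mul_zero]
  · refine (shiftCoord_eq_zero j (monomial α) hβ).trans ?_
    refine (lp.single_apply_ne (E := fun _ : Fin d → ℕ => ℂ) 2 _ _ ?_).symm
    rintro rfl
    exact hβ ⟨α, rfl⟩

lemma commute_coordMul (i j : Fin d) : Commute (coordMul i) (coordMul j) := by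
  refine ContinuousLinearMap.ext_on (dense_span_monomial d) ?_
  rintro _ ⟨α, rfl⟩
  change coordMul i (coordMul j (monomial α)) = coordMul j (coordMul i (monomial α))
  simp only [coordMul_monomial, incr, add_right_comm]

/-- The operator of multiplication by `z^α`. -/
def monomialMul (α : Fin d → ℕ) : DASpace d →L[ℂ] DASpace d :=
  (List.ofFn fun j => coordMul j ^ α j).prod

lemma coe_monomialMul (α : Fin d → ℕ) :
    (monomialMul α).toLinearMap = tuplePow (fun j => (coordMul j).toLinearMap) α := by
  refine (map_list_prod toLinearMapRingHom _).trans ?_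
  rw [List.map_ofFn]
  refine congrArg (fun f => (List.ofFn f).prod) (funext fun j => ?_)
  exact map_pow toLinearMapRingHom (coordMul j) (α j)

lemma isMultiplicationBy_monomialMul (α : Fin d → ℕ) :
    IsMultiplicationBy (monomialMul α) fun z => ∏ j, (z : EuclideanSpace ℂ (Fin d)) j ^ α j := by
  intro g z
  have hcomp := comp_tuplePow (S := (evalCLM z).toLinearMap)
    (A := fun j => (coordMul j).toLinearMap)
    (B := fun j => algebraMap ℂ (Module.End ℂ ℂ) ((z : EuclideanSpace ℂ (Fin d)) j))
    (fun j => LinearMap.ext fun f => evalAt_coordMul j f z) α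
  have hscalar : tuplePow
      (fun j => algebraMap ℂ (Module.End ℂ ℂ) ((z : EuclideanSpace ℂ (Fin d)) j)) α =
      algebraMap ℂ _ (∏ j, (z : EuclideanSpace ℂ (Fin d)) j ^ α j) := by
    rw [tuplePow, ← List.prod_ofFn, map_list_prod, List.map_ofFn]
    simp only [Function.comp_def, map_pow]
  rw [hscalar, ← coe_monomialMul] at hcomp
  exact LinearMap.congr_fun hcomp g

end Multipliers

section Characters

variable {d : ℕ}

lemma character_monomial {Φ : DASpace d →L[ℂ] ℂ} {l : Fin d → ℂ}
    (hΦ : ∀ j f, Φ (coordMul j f) = l j * Φ f) (α : Fin d → ℕ) :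
    Φ (monomial α) = (∏ j, l j ^ α j) * Φ (monomial 0) := by
  induction hm : ∑ j, α j generalizing α with
  | zero =>
    obtain rfl : α = 0 := funext fun i => Finset.sum_eq_zero_iff.1 hm i (Finset.mem_univ i)
    simp
  | succ m ih =>
    obtain ⟨j, -, hj⟩ := Finset.exists_ne_zero_of_sum_ne_zero (hm.trans_ne m.succ_ne_zero)
    obtain ⟨β, rfl⟩ := mem_range_incr j hj
    have hβ : ∑ i, β i = m := by simpa [incr, Finset.sum_add_distrib] using hm
    rw [← coordMul_monomial, hΦ, ih β hβ, ← mul_assoc]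
    congr 1
    simp only [incr, Pi.add_apply, pow_add, Finset.prod_mul_distrib, Pi.single_apply, pow_ite,
      pow_one, pow_zero, Finset.prod_ite_eq', Finset.mem_univ, if_true, mul_comm]

lemma sum_lt_one_of_summable_weight {t : Fin d → ℝ}
    (hs : Summable fun α : Fin d → ℕ => weight α * ∏ j, t j ^ α j) : ∑ j, t j < 1 := by
  have hdegree (m : ℕ) : (fun α : Fin d → ℕ => ∑ i, α i) ⁻¹' {m} =
      Finset.piAntidiag (Finset.univ : Finset (Fin d)) m := by
    ext α
    simp
  have hgeom := (hs.hasSum.tsum_fiberwise fun α => ∑ i, α i).summable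
  have hfiber (m : ℕ) : ∑' α : (fun α : Fin d → ℕ => ∑ i, α i) ⁻¹' {m},
      weight α.1 * ∏ j, t j ^ α.1 j = (∑ j, t j) ^ m := by
    rw [hdegree, ← sum_weight_degree]
    exact Finset.tsum_subtype' _ fun α : Fin d → ℕ => weight α * ∏ j, t j ^ α j
  simp only [hfiber, summable_geometric_iff_norm_lt_one] at hgeom
  exact (le_abs_self _).trans_lt hgeom

/-- The coordinates of the Riesz vector of `Φ` are the values of `Φ` on normalized monomials, so
the square summability of these coordinates is a multiple of the series `∑ |α|!/α! |l^α|²`, which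
converges only in the ball. -/
lemma norm_lt_one_of_character {Φ : DASpace d →L[ℂ] ℂ} (hΦ0 : Φ ≠ 0)
    {l : EuclideanSpace ℂ (Fin d)} (hΦ : ∀ j f, Φ (coordMul j f) = l j * Φ f) : ‖l‖ < 1 := by
  have hone : Φ (monomial 0) ≠ 0 := fun h0 => hΦ0 <|
    ContinuousLinearMap.ext_on (dense_span_monomial d) <| by
      rintro _ ⟨α, rfl⟩
      rw [character_monomial hΦ, h0, mul_zero, zero_apply]
  set u := (InnerProductSpace.toDual ℂ (DASpace d)).symm Φ
  have hu (α : Fin d → ℕ) :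
      ‖u α‖ ^ 2 = (weight α * ∏ j, (‖l j‖ ^ 2) ^ α j) * ‖Φ (monomial 0)‖ ^ 2 := by
    have hin : inner ℂ u (monomial α) = Φ (monomial α) := InnerProductSpace.toDual_symm_apply
    rw [monomial, lp.inner_single_right, ← monomial, character_monomial hΦ] at hin
    have hnorm := congrArg (‖·‖ ^ 2) hin
    simp only [RCLike.inner_apply, RCLike.norm_conj, Complex.norm_real, norm_inv, norm_mul,
      norm_prod, norm_pow, mul_pow, inv_pow, ← Finset.prod_pow, pow_right_comm _ _ 2,
      Real.norm_of_nonneg (Real.sqrt_nonneg _), Real.sq_sqrt (weight_pos α).le] at hnorm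
    rw [mul_assoc, ← hnorm, mul_inv_cancel_left₀ (weight_pos α).ne']
  have hsum : Summable fun α => ‖u α‖ ^ 2 := by
    simpa using (lp.memℓp u).summable (by norm_num)
  simp only [hu] at hsum
  rw [summable_mul_right_iff (by positivity)] at hsum
  have hlt := sum_lt_one_of_summable_weight hsum
  rwa [← EuclideanSpace.norm_sq_eq, sq_lt_one_iff₀ (norm_nonneg _)] at hlt

end Characters

section CompressedShift

variable {d n : ℕ} {P : DASpace d →L[ℂ] DASpace d}

lemma rangeRestrict_comp_coordMul (hP : P ∈ coinvariantProjections d n) (j : Fin d) :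
    P.toLinearMap.rangeRestrict ∘ₗ (coordMul j).toLinearMap =
      compressedShift P j ∘ₗ P.toLinearMap.rangeRestrict := by
  have hco := congrArg adjoint (hP.2.2.1 (coordMul j) ⟨_, evalAt_coordMul j⟩)
  simp only [adjoint_comp, adjoint_adjoint, hP.2.1] at hco
  ext1 f
  exact Subtype.ext (DFunLike.congr_fun hco f).symm

lemma commute_compressedShift (hP : P ∈ coinvariantProjections d n) (i j : Fin d) :
    Commute (compressedShift P i) (compressedShift P j) := by
  have hπ (j f) := LinearMap.congr_fun (rangeRestrict_comp_coordMul hP j) f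
  simp only [LinearMap.comp_apply] at hπ
  refine LinearMap.ext fun v => ?_
  obtain ⟨f, rfl⟩ := P.toLinearMap.surjective_rangeRestrict v
  rw [mul_apply, mul_apply, ← hπ, ← hπ, ← hπ, ← hπ]
  exact congrArg _ (DFunLike.congr_fun (commute_coordMul i j).eq f)

lemma trace_tuplePow_compressedShift (hP : P ∈ coinvariantProjections d n) (α : Fin d → ℕ) :
    LinearMap.trace ℂ _ (tuplePow (compressedShift P) α) =
      rangeTrace (P ∘L monomialMul α).toLinearMap := by
  have := hP.2.2.2.1
  rw [rangeTrace_eq_trace_restrict (F := (P ∘L monomialMul α).toLinearMap)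
    (W := LinearMap.range P.toLinearMap) fun v => ⟨_, rfl⟩]
  congr 1
  ext1 v
  have hv : P.toLinearMap.rangeRestrict v = v := by
    obtain ⟨_, f, rfl⟩ := v
    exact Subtype.ext (DFunLike.congr_fun hP.1 f)
  have hcomp := comp_tuplePow (rangeRestrict_comp_coordMul hP) α
  rw [← coe_monomialMul] at hcomp
  conv_lhs => rw [← hv]
  exact (LinearMap.congr_fun hcomp v).symm

lemma isSpectralTuple_compressedShift_iff (hP : P ∈ coinvariantProjections d n)
    {x : Fin n → EuclideanSpace ℂ (Fin d)} :
    IsSpectralTuple (compressedShift P) x ↔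
      ∀ α, rangeTrace (P ∘L monomialMul α).toLinearMap = ∑ i, ∏ j, x i j ^ α j := by
  have := hP.2.2.2.1
  simp only [isSpectralTuple_iff_trace (commute_compressedShift hP) hP.2.2.2.2,
    trace_tuplePow_compressedShift hP]

lemma exists_ball_isSpectralTuple (hP : P ∈ coinvariantProjections d n) :
    ∃ x : Fin n → Ball d, IsSpectralTuple (compressedShift P) fun i => (x i).1 := by
  have := hP.2.2.2.1
  obtain ⟨x, hx, -⟩ := exists_isSpectralTuple_trace_eq (commute_compressedShift hP) hP.2.2.2.2
  refine ⟨fun i => ⟨x i, mem_ball_zero_iff.2 ?_⟩, hx⟩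
  obtain ⟨χ, hχ0, hχ⟩ := hx.exists_dual_eigenvector (commute_compressedShift hP) hP.2.2.2.2 i
  let Φ : DASpace d →L[ℂ] ℂ := χ.toContinuousLinearMap ∘L P.rangeRestrict
  refine norm_lt_one_of_character (Φ := Φ) (fun hΦ => hχ0 ?_) fun j f => ?_
  · ext v
    obtain ⟨f, rfl⟩ := P.toLinearMap.surjective_rangeRestrict v
    exact DFunLike.congr_fun hΦ f
  · exact (congrArg χ (LinearMap.congr_fun (rangeRestrict_comp_coordMul hP j) f)).trans (hχ j _)

end CompressedShift

section LeadingCoefficients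

variable {E : Type*} [NormedAddCommGroup E] [NormedSpace ℂ E] [CompleteSpace E]

/-- The lowest order of vanishing `N` at `0` among the functions `t ↦ e t f` is attained, so the
coefficient of `t^N` is a nonzero functional of `f`. It is bounded by the Banach–Steinhaus
theorem. -/
lemma exists_leadingCoeff_functional {e : ℂ → E →L[ℂ] ℂ}
    (he : ∀ f, AnalyticAt ℂ (fun t => e t f) 0) (hne : ∃ f, ¬ ∀ᶠ t in 𝓝 0, e t f = 0) :
    ∃ (N : ℕ) (φ : E →L[ℂ] ℂ), φ ≠ 0 ∧
      ∀ f, Tendsto (fun t => (t ^ N)⁻¹ * e t f) (𝓝[≠] 0) (𝓝 (φ f)) := by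
  classical
  have hN : ∃ N : ℕ, ∃ f, analyticOrderAt (fun t => e t f) 0 = N := by
    obtain ⟨f, hf⟩ := hne
    rw [← analyticOrderAt_eq_top] at hf
    obtain ⟨N, hN⟩ := ENat.ne_top_iff_exists.1 hf
    exact ⟨N, f, hN.symm⟩
  set N := Nat.find hN
  have hle (f : E) : (N : ℕ∞) ≤ analyticOrderAt (fun t => e t f) 0 := by
    cases hf : analyticOrderAt (fun t => e t f) 0 with
    | top => exact le_top
    | coe m => exact Nat.cast_le.2 (Nat.find_min' hN ⟨f, hf⟩)
  have hlim {f : E} {g : ℂ → ℂ} (hg : AnalyticAt ℂ g 0)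
      (hfg : ∀ᶠ t in 𝓝 0, e t f = (t - 0) ^ N • g t) :
      Tendsto (fun t => (t ^ N)⁻¹ * e t f) (𝓝[≠] 0) (𝓝 (g 0)) := by
    refine (hg.continuousAt.tendsto.mono_left nhdsWithin_le_nhds).congr' ?_
    filter_upwards [nhdsWithin_le_nhds hfg, self_mem_nhdsWithin] with t ht ht0
    rw [ht, sub_zero, smul_eq_mul, inv_mul_cancel_left₀ (pow_ne_zero N ht0)]
  choose g hg hfg using fun f => (natCast_le_analyticOrderAt (he f)).1 (hle f)
  let φ : E →L[ℂ] ℂ := continuousLinearMapOfTendsto (fun t => (t ^ N)⁻¹ • e t)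
    (tendsto_pi_nhds.2 fun f => hlim (hg f) (hfg f))
  refine ⟨N, φ, fun hφ => ?_, fun f => hlim (hg f) (hfg f)⟩
  obtain ⟨f, hf⟩ := Nat.find_spec hN
  obtain ⟨k, hk, hk0, hfk⟩ := (he f).analyticOrderAt_eq_natCast.1 hf
  exact hk0 <| (tendsto_nhds_unique (hlim hk hfk) (hlim (hg f) (hfg f))).trans
    (DFunLike.congr_fun hφ f)

end LeadingCoefficients

section Lines

variable {d : ℕ}

open Classical in
/-- The point `z + t e_j` of the complex line through `z` in the direction of the `j`-th
coordinate if it lies in the ball, which is the case for small `t`, and `z` otherwise. -/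
def linePoint (j : Fin d) (z : Ball d) (t : ℂ) : Ball d :=
  if h : z.1 + t • EuclideanSpace.single j 1 ∈ Metric.ball 0 1 then ⟨_, h⟩ else z

lemma coe_linePoint_eventually (j : Fin d) (z : Ball d) :
    ∀ᶠ t in 𝓝 0, (linePoint j z t).1 = z.1 + t • EuclideanSpace.single j 1 := by
  have hcont : Continuous fun t : ℂ => z.1 + t • EuclideanSpace.single j 1 := by fun_prop
  have hmem := (Metric.isOpen_ball (x := (0 : EuclideanSpace ℂ (Fin d))) (ε := 1)).preimage hcont
  filter_upwards [hmem.mem_nhds (by simp)] with t ht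
  exact congrArg Subtype.val (dif_pos ht)

lemma linePoint_zero (j : Fin d) (z : Ball d) : linePoint j z 0 = z :=
  Subtype.ext <| by simpa using (coe_linePoint_eventually j z).self_of_nhds

lemma analyticAt_evalAt_linePoint (j : Fin d) (z : Ball d) (f : DASpace d) :
    AnalyticAt ℂ (fun t => evalAt f (linePoint j z t)) 0 := by
  have hcont : Continuous fun ε : ℝ =>
      (WithLp.toLp 2 fun i => (‖z.1 i‖ : ℂ)) + (ε : ℂ) • EuclideanSpace.single j 1 := by fun_prop
  have hsmall : ∀ᶠ ε : ℝ in 𝓝 0,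
      (WithLp.toLp 2 fun i => (‖z.1 i‖ : ℂ)) + (ε : ℂ) • EuclideanSpace.single j 1 ∈
        Metric.ball 0 1 := by
    refine hcont.continuousAt.eventually (Metric.isOpen_ball.mem_nhds ?_)
    have hz := mem_ball_zero_iff.1 z.2
    rw [EuclideanSpace.norm_eq] at hz
    simpa [EuclideanSpace.norm_eq] using hz
  obtain ⟨ε, hball, hε⟩ := ((hsmall.filter_mono nhdsWithin_le_nhds).and
    (self_mem_nhdsWithin (s := Ioi 0))).exists
  have hdiff : DifferentiableOn ℂ (fun t : ℂ => ∑' α : Fin d → ℕ, f α * (√(weight α) : ℂ) *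
      ∏ i, (z.1 + t • EuclideanSpace.single j 1).ofLp i ^ α i) (Metric.ball 0 ε) := by
    refine Complex.differentiableOn_tsum_of_summable_norm (summable_evalAt f ⟨_, hball⟩).norm
      (fun α => ?_) Metric.isOpen_ball fun α t ht => ?_
    · simp only [PiLp.add_apply, PiLp.smul_apply]
      fun_prop
    · simp only [norm_mul, norm_prod, norm_pow]
      gcongr with i
      by_cases hi : i = j
      · subst hi
        simpa [← Complex.ofReal_add, abs_of_pos (add_pos_of_nonneg_of_pos (norm_nonneg _) hε)] using
          norm_add_le_of_le le_rfl (mem_ball_zero_iff.1 ht).le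
      · simp [hi]
  refine (hdiff.analyticAt (Metric.ball_mem_nhds 0 hε)).congr ?_
  filter_upwards [coe_linePoint_eventually j z] with t ht
  rw [evalAt, ht]

end Lines

section Polynomials

variable {d : ℕ}

lemma IsMultiplicationBy.aeval {T : DASpace d →L[ℂ] DASpace d} {φ : Ball d → ℂ}
    (hT : IsMultiplicationBy T φ) (q : Polynomial ℂ) :
    IsMultiplicationBy (Polynomial.aeval T q) fun z => q.eval (φ z) := by
  intro g z
  induction q using Polynomial.induction_on' with
  | add p q hp hq =>
    simp only [map_add, Polynomial.eval_add, add_mul, ← hp, ← hq]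
    exact map_add (evalCLM z) _ _
  | monomial n a =>
    have hpow : evalAt ((T ^ n) g) z = φ z ^ n * evalAt g z := by
      induction n with
      | zero => simp
      | succ n ih =>
        rw [pow_succ', pow_succ', mul_assoc, ← ih]
        exact hT _ _
    simp only [Polynomial.aeval_monomial, Polynomial.eval_monomial, mul_assoc, ← hpow,
      ← Algebra.smul_def]
    exact map_smul (evalCLM z) a _

lemma exists_mem_orthogonal_evalAt_eq_eval (V : Submodule ℂ (DASpace d)) [FiniteDimensional ℂ V]
    (j : Fin d) :
    ∃ q : Polynomial ℂ, q ≠ 0 ∧ ∃ f ∈ Vᗮ, ∀ z : Ball d, evalAt f z = q.eval (z.1 j) := by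
  let L : Polynomial ℂ →ₗ[ℂ] V := V.orthogonalProjectionOnto.toLinearMap ∘ₗ
    LinearMap.applyₗ (monomial 0) ∘ₗ (coeLM ℂ) ∘ₗ (Polynomial.aeval (coordMul j)).toLinearMap
  have hL : LinearMap.ker L ≠ ⊥ := fun h =>
    Polynomial.not_finite (Module.Finite.of_injective L (LinearMap.ker_eq_bot.1 h))
  obtain ⟨q, hq, hq0⟩ := Submodule.exists_mem_ne_zero_of_ne_bot hL
  refine ⟨q, hq0, Polynomial.aeval (coordMul j) q (monomial 0), ?_, fun z => ?_⟩
  · exact Submodule.orthogonalProjectionOnto_eq_zero_iff.1 hq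
  · have hq := IsMultiplicationBy.aeval (evalAt_coordMul j) q (monomial 0) z
    simpa [evalAt_monomial] using hq

lemma not_eventually_eval_add_eq_zero {q : Polynomial ℂ} (hq : q ≠ 0) (a : ℂ) :
    ¬ ∀ᶠ t in 𝓝 0, q.eval (a + t) = 0 := fun h => by
  refine hq (Polynomial.eq_zero_of_infinite_isRoot q (Infinite.mono ?_
    ((infinite_of_mem_nhds 0 h).image (add_right_injective a).injOn)))
  rintro _ ⟨t, ht, rfl⟩
  exact ht

end Polynomials

section Surjectivity

variable {d n : ℕ} {V : Submodule ℂ (DASpace d)}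

/-- `V` is invariant under the adjoints of all multiplication operators, that is, the orthogonal
complement of `V` is invariant under the multiplication operators themselves. -/
def IsMultiplierCoinvariant (V : Submodule ℂ (DASpace d)) : Prop :=
  ∀ T ∈ multiplierOperators d, ∀ f ∈ Vᗮ, T f ∈ Vᗮ

lemma starProjection_mem_coinvariantProjections [FiniteDimensional ℂ V]
    (hV : IsMultiplierCoinvariant V) (hn : Module.finrank ℂ V = n) :
    V.starProjection ∈ coinvariantProjections d n := by
  have hrange : LinearMap.range V.starProjection.toLinearMap = V := V.range_starProjection
  have hadj : adjoint V.starProjection = V.starProjection := isSelfAdjoint_starProjection V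
  refine ⟨V.isIdempotentElem_starProjection, hadj, fun T hT => ?_, ?_, ?_⟩
  · have hPT : V.starProjection ∘L T ∘L V.starProjection = V.starProjection ∘L T := by
      ext1 f
      have hf : T (f - V.starProjection f) ∈ Vᗮ := hV T hT _ (V.sub_starProjection_mem_orthogonal f)
      rw [← Submodule.starProjection_apply_eq_zero_iff, map_sub, map_sub, sub_eq_zero] at hf
      exact hf.symm
    simpa [adjoint_comp, hadj, comp_assoc] using congrArg adjoint hPT
  · rwa [hrange]
  · rwa [hrange]

/-- The vector `u` represents the leading coefficient of `t ↦ f(z + t e_j)` for `f` in the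
complement of `V`. Since multiplication by `φ` multiplies it by `φ z`, it is a joint eigenvector
of the adjoints even when the value at `z` vanishes on this complement. -/
lemma exists_orthogonal_multiplier_eigenvector [FiniteDimensional ℂ V]
    (hV : IsMultiplierCoinvariant V) (j : Fin d) (z : Ball d) :
    ∃ u ∈ Vᗮ, u ≠ 0 ∧ ∀ T φ, IsMultiplicationBy T φ →
      ∀ f ∈ Vᗮ, inner ℂ u (T f) = φ z * inner ℂ u f := by
  have hne : ∃ f : Vᗮ, ¬ ∀ᶠ t in 𝓝 0, evalAt f.1 (linePoint j z t) = 0 := by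
    obtain ⟨q, hq, f, hf, hfq⟩ := exists_mem_orthogonal_evalAt_eq_eval V j
    refine ⟨⟨f, hf⟩, fun h => not_eventually_eval_add_eq_zero hq (z.1 j) ?_⟩
    filter_upwards [h, coe_linePoint_eventually j z] with t ht hzt
    simpa [hfq, hzt] using ht
  obtain ⟨N, Λ, hΛ0, hΛ⟩ := exists_leadingCoeff_functional
    (e := fun t => evalCLM (linePoint j z t) ∘L Vᗮ.subtypeL)
    (fun f => analyticAt_evalAt_linePoint j z f) hne
  let u := (InnerProductSpace.toDual ℂ Vᗮ).symm Λ
  have hu (f : Vᗮ) : inner ℂ u.1 f.1 = Λ f :=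
    InnerProductSpace.toDual_symm_apply (𝕜 := ℂ) (E := Vᗮ)
  refine ⟨u, u.2, fun h0 => hΛ0 ?_, fun T φ hT f hf => ?_⟩
  · ext f
    rw [← hu, h0, inner_zero_left, zero_apply]
  have hφ : Tendsto (fun t => φ (linePoint j z t)) (𝓝[≠] 0) (𝓝 (φ z)) := by
    have hT1 (w : Ball d) : evalAt (T (monomial 0)) w = φ w := by
      simpa [evalAt_monomial] using hT (monomial 0) w
    have hcont := (analyticAt_evalAt_linePoint j z (T (monomial 0))).continuousAt.tendsto
    simp only [hT1, linePoint_zero] at hcont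
    exact hcont.mono_left nhdsWithin_le_nhds
  have hTf : T f ∈ Vᗮ := hV T ⟨φ, hT⟩ f hf
  have hlim := (hφ.mul (hΛ ⟨f, hf⟩)).congr fun t => show _ = (t ^ N)⁻¹ * evalAt (T f) _ by
    rw [hT, mul_left_comm]
    rfl
  exact (hu ⟨T f, hTf⟩).trans <| (tendsto_nhds_unique (hΛ ⟨T f, hTf⟩) hlim).trans <|
    congrArg _ (hu ⟨f, hf⟩).symm

lemma rangeTrace_starProjection_span_singleton_comp {𝕜 H : Type*} [RCLike 𝕜] [NormedAddCommGroup H]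
    [InnerProductSpace 𝕜 H] {u : H} (hu : u ≠ 0) {T : H →L[𝕜] H} {c : 𝕜}
    (hT : inner 𝕜 u (T u) = c * inner 𝕜 u u) :
    rangeTrace ((𝕜 ∙ u).starProjection ∘L T).toLinearMap = c := by
  have hmem (v : H) : ((𝕜 ∙ u).starProjection ∘L T).toLinearMap v ∈ 𝕜 ∙ u :=
    Submodule.starProjection_apply_mem _ _
  have hu0 : inner 𝕜 u u ≠ 0 := inner_self_ne_zero.2 hu
  have hscalar : ((𝕜 ∙ u).starProjection ∘L T).toLinearMap.restrict (fun v _ => hmem v) =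
      c • LinearMap.id (M := 𝕜 ∙ u) := by
    ext ⟨v, hv⟩
    obtain ⟨a, rfl⟩ := Submodule.mem_span_singleton.1 hv
    have hTu : (𝕜 ∙ u).starProjection (T u) = c • u := by
      rw [Submodule.starProjection_singleton, hT, RCLike.ofReal_pow, ← inner_self_eq_norm_sq_to_K,
        mul_div_cancel_right₀ c hu0]
    simp [hTu, smul_comm a c]
  rw [rangeTrace_eq_trace_restrict hmem, hscalar, map_smul, LinearMap.trace_id,
    finrank_span_singleton hu, Nat.cast_one, smul_eq_mul, mul_one]

lemma starProjection_sup {𝕜 H : Type*} [RCLike 𝕜] [NormedAddCommGroup H]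
    [InnerProductSpace 𝕜 H] {U W : Submodule 𝕜 H} [U.HasOrthogonalProjection]
    [W.HasOrthogonalProjection] [(U ⊔ W).HasOrthogonalProjection] (h : U ⟂ W) :
    (U ⊔ W).starProjection = U.starProjection + W.starProjection := by
  ext1 v
  have hU := Submodule.starProjection_apply_mem U v
  have hW := Submodule.starProjection_apply_mem W v
  refine Submodule.eq_starProjection_of_mem_orthogonal
    (add_mem (Submodule.mem_sup_left hU) (Submodule.mem_sup_right hW)) ?_
  rw [← Submodule.inf_orthogonal, add_apply]
  constructor
  · rw [← sub_sub]
    exact sub_mem (U.sub_starProjection_mem_orthogonal v) (h.symm hW)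
  · rw [← sub_sub, sub_right_comm]
    exact sub_mem (W.sub_starProjection_mem_orthogonal v) (h hU)

lemma exists_coinvariant_rangeTrace_eq (j : Fin d) (x : Fin n → Ball d) :
    ∃ V : Submodule ℂ (DASpace d), ∃ _ : FiniteDimensional ℂ V, Module.finrank ℂ V = n ∧
      IsMultiplierCoinvariant V ∧ ∀ T φ, IsMultiplicationBy T φ →
        rangeTrace (V.starProjection ∘L T).toLinearMap = ∑ i, φ (x i) := by
  induction n with
  | zero =>
    refine ⟨⊥, inferInstance, finrank_bot ℂ _, fun T _ f _ => by simp, fun T φ _ => ?_⟩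
    rw [Submodule.starProjection_bot, zero_comp, Fin.sum_univ_zero]
    exact rangeTrace_zero
  | succ n ih =>
    obtain ⟨V, _, hn, hV, htrace⟩ := ih (x ∘ Fin.succ)
    obtain ⟨u, hu, hu0, heig⟩ := exists_orthogonal_multiplier_eigenvector hV j (x 0)
    have hort : (ℂ ∙ u) ⟂ V := (Submodule.span_singleton_le_iff_mem _ _).2 hu
    refine ⟨(ℂ ∙ u) ⊔ V, inferInstance, ?_, fun T hT f hf => ?_, fun T φ hT => ?_⟩
    · rw [← add_zero (Module.finrank ℂ _), ← finrank_bot ℂ (DASpace d), ← hort.disjoint.eq_bot,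
        Submodule.finrank_sup_add_finrank_inf_eq, finrank_span_singleton hu0, hn, add_comm]
    · obtain ⟨φ, hT'⟩ := hT
      rw [← Submodule.inf_orthogonal] at hf ⊢
      refine ⟨Submodule.mem_orthogonal_singleton_iff_inner_right.2 ?_, hV T ⟨φ, hT'⟩ f hf.2⟩
      rw [heig T φ hT' f hf.2, Submodule.mem_orthogonal_singleton_iff_inner_right.1 hf.1, mul_zero]
    · rw [starProjection_sup hort, add_comp, toLinearMap_add,
        rangeTrace_add (fun v => Submodule.starProjection_apply_mem (ℂ ∙ u) (T v))
          fun v => Submodule.starProjection_apply_mem V (T v), htrace T φ hT,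
        rangeTrace_starProjection_span_singleton_comp hu0 (heig T φ hT u hu), Fin.sum_univ_succ]
      rfl

lemma exists_isSpectralTuple_compressedShift (j : Fin d) (x : Fin n → Ball d) :
    ∃ P ∈ coinvariantProjections d n, IsSpectralTuple (compressedShift P) fun i => (x i).1 := by
  obtain ⟨V, _, hn, hV, htrace⟩ := exists_coinvariant_rangeTrace_eq j x
  have hP := starProjection_mem_coinvariantProjections hV hn
  exact ⟨_, hP, (isSpectralTuple_compressedShift_iff hP).2 fun α =>
    htrace _ _ (isMultiplicationBy_monomialMul α)⟩

end Surjectivity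

section Continuity

variable {d n : ℕ}

lemma ballInvolution_self (x : EuclideanSpace ℂ (Fin d)) : ballInvolution x x = 0 := by
  rcases eq_or_ne x 0 with rfl | hx
  · simp [ballInvolution]
  · have hproj : inner ℂ x x / ((‖x‖ ^ 2 : ℝ) : ℂ) = 1 := by
      rw [inner_self_eq_norm_sq_to_K, Complex.ofReal_pow]
      exact div_self (pow_ne_zero 2 (by simpa using hx))
    simp only [ballInvolution, hproj, one_smul, sub_self, smul_zero]

lemma continuousAt_ballInvolution {x : EuclideanSpace ℂ (Fin d)} (hx : ‖x‖ < 1) :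
    ContinuousAt (fun l => ballInvolution l x) x := by
  rcases eq_or_ne x 0 with rfl | h0
  · simpa [ballInvolution] using continuousAt_id' 0
  · have hnum : (1 : ℂ) - inner ℂ x x ≠ 0 := by
      rw [inner_self_eq_norm_sq_to_K, sub_ne_zero, ← RCLike.ofReal_pow]
      exact Complex.ofReal_ne_one.2 (pow_lt_one₀ (norm_nonneg x) hx two_ne_zero).ne |>.symm
    have hden : ((‖x‖ ^ 2 : ℝ) : ℂ) ≠ 0 := by simpa using h0
    unfold ballInvolution
    fun_prop (disch := assumption)

lemma tendsto_phDist {ι : Type*} {F : Filter ι} {x : ι → Ball d} {y : Ball d}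
    (h : Tendsto x F (𝓝 y)) : Tendsto (fun k => phDist (x k) y) F (𝓝 0) := by
  have hy := (continuousAt_ballInvolution (mem_ball_zero_iff.1 y.2)).norm.tendsto.comp
    ((continuous_subtype_val.tendsto y).comp h)
  rwa [ballInvolution_self, norm_zero] at hy

lemma symDist_nonneg (X Y : SymPolyball d n) : 0 ≤ symDist X Y := by
  induction X, Y using Quotient.inductionOn₂
  exact Real.iInf_nonneg fun _ => Real.iSup_nonneg fun _ => norm_nonneg _

lemma symDist_mk_le_polyDist (x y : Fin n → Ball d) :
    symDist (Quotient.mk (permSetoid d n) x) (Quotient.mk (permSetoid d n) y) ≤ polyDist x y :=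
  ciInf_le (f := fun s : Equiv.Perm (Fin n) => polyDist x (y ∘ s)) (finite_range _).bddBelow 1

lemma polyDist_le_sum_phDist (x y : Fin n → Ball d) : polyDist x y ≤ ∑ i, phDist (x i) (y i) :=
  Real.iSup_le (fun i => Finset.single_le_sum (f := fun i => phDist (x i) (y i))
    (fun _ _ => norm_nonneg _) (Finset.mem_univ i)) (Finset.sum_nonneg fun _ _ => norm_nonneg _)

lemma tendsto_symDist_of_tendsto {ι : Type*} {F : Filter ι} {x : ι → Fin n → Ball d}
    {y : Fin n → Ball d} (h : Tendsto x F (𝓝 y)) :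
    Tendsto (fun k => symDist (Quotient.mk (permSetoid d n) (x k))
      (Quotient.mk (permSetoid d n) y)) F (𝓝 0) := by
  have hsum : Tendsto (fun k => ∑ i, phDist (x k i) (y i)) F (𝓝 0) := by
    simpa using tendsto_finsetSum Finset.univ fun i _ => tendsto_phDist (tendsto_pi_nhds.1 h i)
  exact squeeze_zero (fun k => symDist_nonneg _ _)
    (fun k => (symDist_mk_le_polyDist _ _).trans (polyDist_le_sum_phDist _ _)) hsum

/-- Along an ultrafilter the tuples converge in the compact closed polyball; the limit has the
same moments as `y`, hence is a permutation of `y`, which lies in the open polyball. -/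
lemma tendsto_symDist_of_tendsto_moments {ι : Type*} {F : Filter ι} {x : ι → Fin n → Ball d}
    {y : Fin n → Ball d} (h : ∀ α : Fin d → ℕ, Tendsto (fun k => ∑ i, ∏ j, (x k i).1 j ^ α j) F
      (𝓝 (∑ i, ∏ j, (y i).1 j ^ α j))) :
    Tendsto (fun k => symDist (Quotient.mk (permSetoid d n) (x k))
      (Quotient.mk (permSetoid d n) y)) F (𝓝 0) := by
  refine (tendsto_iff_ultrafilter _ _ _).2 fun U hU => ?_
  let K : Set (Fin n → EuclideanSpace ℂ (Fin d)) := univ.pi fun _ => Metric.closedBall 0 1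
  have hK : IsCompact K := isCompact_univ_pi fun _ => isCompact_closedBall _ _
  obtain ⟨a, -, hle⟩ := hK.ultrafilter_le_nhds (U.map fun k i => (x k i).1) <|
    tendsto_principal.2 <| Eventually.of_forall fun k i _ =>
      Metric.ball_subset_closedBall (x k i).2
  have ha : Tendsto (fun k i => (x k i).1) U (𝓝 a) := hle
  have hmom (α : Fin d → ℕ) : ∑ i, ∏ j, (y i).1 j ^ α j = ∑ i, ∏ j, a i j ^ α j := by
    have hcont : Continuous fun b : Fin n → EuclideanSpace ℂ (Fin d) =>
        ∑ i, ∏ j, b i j ^ α j := by fun_prop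
    exact tendsto_nhds_unique ((h α).mono_left hU) ((hcont.tendsto a).comp ha)
  obtain ⟨s, hs⟩ := exists_perm_of_card_fiber_eq (card_fiber_eq_of_moments_eq hmom)
  obtain rfl : a = fun i => (y (s i)).1 :=
    funext fun i => WithLp.ofLp_injective 2 (congrFun hs i)
  have hys : Quotient.mk (permSetoid d n) y = Quotient.mk (permSetoid d n) (y ∘ s) :=
    Quotient.sound ⟨s, rfl⟩
  rw [hys]
  refine tendsto_symDist_of_tendsto (tendsto_pi_nhds.2 fun i => tendsto_subtype_rng.2 ?_)
  exact tendsto_pi_nhds.1 ha i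

lemma continuous_rangeTrace_comp (T : DASpace d →L[ℂ] DASpace d) :
    Continuous fun P : coinvariantProjections d n => rangeTrace (P.1 ∘L T).toLinearMap := by
  refine LipschitzWith.continuous (K := (n + n) * ‖T‖₊) (LipschitzWith.of_dist_le_mul ?_)
  rintro ⟨Q, -, -, -, _, hQ⟩ ⟨P, -, -, -, _, hP⟩
  have hle := norm_rangeTrace_comp_sub_le Q P T
  rw [hQ, hP] at hle
  simpa [dist_eq_norm, Subtype.dist_eq, mul_assoc, mul_comm ‖T‖] using hle

end Continuity

end DruryArveson

end

open DruryArveson in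
theorem theorem3p4 (d n : ℕ) (hd : 1 ≤ d) :
    ∃ Ψ : coinvariantProjections d n → SymPolyball d n,
      (∀ (P : coinvariantProjections d n) (l : EuclideanSpace ℂ (Fin d)),
        (Ψ P).mult l = jointSpectrumMult (compressedShift P.1) l) ∧
      Function.Surjective Ψ ∧
      ∀ P : coinvariantProjections d n, ∀ ε : ℝ, 0 < ε → ∃ δ : ℝ, 0 < δ ∧ ∀ Q : coinvariantProjections d n,
        ‖Q.1 - P.1‖ < δ → symDist (Ψ Q) (Ψ P) < ε := by
  choose x hx using fun P : coinvariantProjections d n => exists_ball_isSpectralTuple P.2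
  have hmoment (P : coinvariantProjections d n) :=
    (isSpectralTuple_compressedShift_iff P.2).1 (hx P)
  refine ⟨fun P => Quotient.mk (permSetoid d n) (x P), hx, ?_, fun P ε hε => ?_⟩
  · rintro ⟨y⟩
    obtain ⟨P, hP, hy⟩ := exists_isSpectralTuple_compressedShift ⟨0, hd⟩ y
    obtain ⟨s, hs⟩ := exists_perm_of_card_fiber_eq fun l => (hx ⟨P, hP⟩ l).trans (hy l).symm
    exact ⟨⟨P, hP⟩, Quotient.sound ⟨s, funext fun i => Subtype.ext (congrFun hs i)⟩⟩
  · have hlim := tendsto_symDist_of_tendsto_moments (F := nhds P) (x := x) (y := x P) fun α => by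
      simpa only [hmoment] using
        (continuous_rangeTrace_comp (n := n) (monomialMul α)).tendsto P
    obtain ⟨δ, hδ, hball⟩ := Metric.eventually_nhds_iff.1 (hlim.eventually_lt_const hε)
    refine ⟨δ, hδ, fun Q hQ => hball ?_⟩
    rwa [Subtype.dist_eq, dist_eq_norm]
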